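/- Let $M$ be a smooth manifold (Hausdorff, second countable, without boundary), let $\mathcal F$ be a regular foliation of $M$ with tangent bundle $T\mathcal F\subseteq TM$, and let $\gamma\colon TM\to TM$ be (the projection of) an Ehresmann connection complementary to $T\mathcal F$: a smooth bundle endomorphism with $\gamma^2=\gamma$ and $\operatorname{Im}\gamma=T\mathcal F$. Put $\mathbb H=\ker\gamma$, so that $TM=\mathbb H\oplus T\mathcal F$. For a Lie algebroid $(E,q,[\![\cdot,\cdot]\!])$ over $M$, the associated operator $D\colon\Gamma(\Lambda^pE^*)\to\Gamma(\Lambda^{p+1}E^*)$ is the derivation of degree $1$ with $Df(A)=qA(f)$ and $D\alpha(A,B)=qA(\alpha(B))-qB(\alpha(A))-\alpha([\![A,B]\!])$ for functions $f$, $1$-forms $\alpha$ and sections $A,B$ of $E$; it is given by the Koszul formula $$D\theta(A_0,\dots,A_p)=\sum_i(-1)^i\,qA_i\bigl(\theta(\dots,\widehat{A_i},\dots)\bigr)+\sum_{i<j}(-1)^{i+j}\theta([\![A_i,A_j]\!],\dots,\widehat{A_i},\dots,\widehat{A_j},\dots).$$ For $(TM,\mathrm{Id},[\cdot,\cdot])$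 it is the exterior differential $\mathrm d$. The Lie algebroid of $\mathcal F$ is $T\mathcal F$ with the restriction of the Lie bracket and the inclusion as anchor; its associated operator is the foliated differential $\mathrm d_{\mathcal F}$. The connection $\gamma$ defines a Lie algebroid on $TM$ with anchor $\gamma$ and bracket $$[\![X,Y]\!]=[X,Y]_\gamma+T_\gamma(X,Y),$$ where $[X,Y]_\gamma=[\gamma X,Y]+[X,\gamma Y]-\gamma[X,Y]$ and $T_\gamma(X,Y)=[\gamma X,\gamma Y]-\gamma[\gamma X,Y]-\gamma[X,\gamma Y]+\gamma^2[X,Y]$; let $D$ be its associated operator. A form is of type $(a,b)$ if it has degree $a+b$ and vanishes whenever more than $b$ of its arguments are in $\Gamma(T\mathcal F)$ or more than $a$ are in $\Gamma(\mathbb H)$. With respect to this bigrading $\mathrm d=\mathrm d_{1,0}+\mathrm d_{2,-1}+\mathrm d_{0,1}$, where $\mathrm d_{i,j}$ maps forms of type $(a,b)$ to forms of type $(a+i,b+j)$. Theorem. The operators $D$ and $\mathrm d_{\mathcal F}$ are cohomology operators ($D^2=0$, $\mathrm d_{\mathcal F}^2=0$), and: 1. $D=\mathrm d_{0,1}$.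 2. $\Gamma(T\mathcal F)$ is closed under $[\![\cdot,\cdot]\!]$, and the restriction to $T\mathcal F$ of the Lie algebroid $(TM,\gamma,[\![\cdot,\cdot]\!])$ is the Lie algebroid of $\mathcal F$. 3. Let $\mathbb H^0\subseteq T^*M$ be the annihilator of $\mathbb H$, so that $\Gamma(\Lambda\mathbb H^0)$ consists of the forms which vanish as soon as one argument lies in $\mathbb H$. Then $\mathrm d_{0,1}$ maps $\Gamma(\Lambda^p\mathbb H^0)$ to $\Gamma(\Lambda^{p+1}\mathbb H^0)$, and the complexes $(\Gamma(\Lambda T^*\mathcal F),\mathrm d_{\mathcal F})$ and $(\Gamma(\Lambda\mathbb H^0),\mathrm d_{0,1})$ are isomorphic, through the $C^\infty(M)$-linear isomorphisms $h$ with $(h\alpha)(X_1,\dots,X_p)=\alpha(\gamma X_1,\dots,\gamma X_p)$. -/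

import Mathlib

set_option linter.unusedSectionVars false

open scoped Manifold ContDiff

noncomputable section

namespace FoliatedAlgebroid

section Manifold

variable {n : ℕ} {M : Type*} [TopologicalSpace M] [ChartedSpace (EuclideanSpace ℝ (Fin n)) M]

/-- The ring `C^∞(M)`. -/
abbrev Fun (n : ℕ) (M : Type*) [TopologicalSpace M]
    [ChartedSpace (EuclideanSpace ℝ (Fin n)) M] := C^∞⟮𝓡 n, M; 𝓘(ℝ, ℝ), ℝ⟯

/-- The smooth vector fields on `M`, i.e. the smooth sections of the tangent bundle. -/
abbrev VF (n : ℕ) (M : Type*) [TopologicalSpace M]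
    [ChartedSpace (EuclideanSpace ℝ (Fin n)) M] [IsManifold (𝓡 n) ∞ M] :=
  Cₛ^∞⟮𝓡 n; EuclideanSpace ℝ (Fin n), (TangentSpace (𝓡 n) : M → Type _)⟯

variable [IsManifold (𝓡 n) ∞ M]

instance VF.instSMulFun : SMul (Fun n M) (VF n M) :=
  ⟨fun f X => ⟨fun x => f x • X x, f.contMDiff.smul_section X.contMDiff⟩⟩

@[simp] theorem VF.fun_smul_apply (f : Fun n M) (X : VF n M) (x : M) :
    (f • X) x = f x • X x := rfl

instance VF.instModuleFun : Module (Fun n M) (VF n M) where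
  one_smul X := by ext1 x; simp
  mul_smul f g X := by ext1 x; simp [mul_smul]
  smul_zero f := by ext1 x; simp
  zero_smul X := by ext1 x; simp
  smul_add f X Y := by ext1 x; simp
  add_smul f g X := by ext1 x; simp [add_smul]

instance VF.instTower : IsScalarTower ℝ (Fun n M) (VF n M) where
  smul_assoc c f X := by ext1 x; simp [mul_smul]

theorem VF.mdiff (X : VF n M) (x : M) :
    MDifferentiableAt (𝓡 n) ((𝓡 n).prod 𝓘(ℝ, EuclideanSpace ℝ (Fin n)))
      (fun x => (X x : TangentBundle (𝓡 n) M)) x :=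
  (X.contMDiff x).mdifferentiableAt (by simp)

theorem Fun.mdiff (f : Fun n M) (x : M) : MDifferentiableAt (𝓡 n) 𝓘(ℝ, ℝ) f x :=
  (f.contMDiff x).mdifferentiableAt (by simp)

/-- A vector field `X` as the derivation `f ↦ X f = df(X)` of `C^∞(M)`. -/
def dirDeriv : VF n M →ₗ[Fun n M] Derivation ℝ (Fun n M) (Fun n M) where
  toFun X := Derivation.mk'
    { toFun := fun f => ⟨fun x => mvfderiv (𝓡 n) f x (X x), by
        have h1 := (f.contMDiff.contMDiff_tangentMap (m := ∞) (by simp)).comp X.contMDiff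
        intro x
        have h2 := h1 x
        rw [Bundle.contMDiffAt_totalSpace] at h2
        simpa using! h2.2⟩
      map_add' := fun f g => by
        ext x
        simpa using! congrArg (fun L => L (X x)) (mvfderiv_add (f.mdiff x) (g.mdiff x))
      map_smul' := fun c f => by
        ext x
        have := mvfderiv_smul (I := 𝓡 n) (x := x) (mdifferentiableAt_const (c := c)) (f.mdiff x)
        have := congrArg (fun L => L (X x)) this
        simpa [mvfderiv_const] using! this }
    (fun f g => by
      ext x
      have := congrArg (fun L => L (X x)) (mvfderiv_mul (f.mdiff x) (g.mdiff x))
      simpa using! this)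
  map_add' X Y := by ext f x; exact map_add (mvfderiv (𝓡 n) f x) (X x) (Y x)
  map_smul' f X := by ext g x; exact map_smul (mvfderiv (𝓡 n) g x) (f x) (X x)

@[simp] theorem dirDeriv_apply (X : VF n M) (f : Fun n M) (x : M) :
    dirDeriv X f x = mvfderiv (𝓡 n) f x (X x) := rfl

/-- The Lie bracket `[X, Y]` of vector fields. -/
def lieBr : VF n M →ₗ[ℝ] VF n M →ₗ[ℝ] VF n M :=
  LinearMap.mk₂ ℝ (fun X Y => ⟨fun x => VectorField.mlieBracket (𝓡 n) X Y x, by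
      have : IsManifold (𝓡 n) (minSmoothness ℝ 2) M :=
        IsManifold.of_le (n := ∞) (by simp; exact ENat.LEInfty.out)
      have : IsManifold (𝓡 n) (((⊤ : ℕ∞) : WithTop ℕ∞) + 1) M := by simpa
      exact ContDiff.mlieBracket_vectorField (n := ⊤) X.contMDiff Y.contMDiff (by simp)⟩)
    (fun X X' Y => by ext1 x; exact VectorField.mlieBracket_add_left (X.mdiff x) (X'.mdiff x))
    (fun c X Y => by ext1 x; exact VectorField.mlieBracket_const_smul_left (X.mdiff x))
    (fun X Y Y' => by ext1 x; exact VectorField.mlieBracket_add_right (Y.mdiff x) (Y'.mdiff x))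
    (fun c X Y => by ext1 x; exact VectorField.mlieBracket_const_smul_right (Y.mdiff x))

theorem lieBr_apply (X Y : VF n M) (x : M) :
    lieBr X Y x = VectorField.mlieBracket (𝓡 n) X Y x := rfl

theorem lieBr_self (X : VF n M) : lieBr X X = 0 := by
  ext1 x; simp [lieBr_apply]

theorem lieBr_jacobi (X Y Z : VF n M) :
    lieBr X (lieBr Y Z) = lieBr (lieBr X Y) Z + lieBr Y (lieBr X Z) := by
  have : IsManifold (𝓡 n) (minSmoothness ℝ 3) M := IsManifold.of_le (n := ∞) (by simp; exact ENat.LEInfty.out)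
  ext1 x
  exact VectorField.leibniz_identity_mlieBracket_apply ((X.contMDiff x).of_le (by simp; exact ENat.LEInfty.out))
    ((Y.contMDiff x).of_le (by simp; exact ENat.LEInfty.out)) ((Z.contMDiff x).of_le (by simp; exact ENat.LEInfty.out))

theorem lieBr_leibniz (X Y : VF n M) (f : Fun n M) :
    lieBr X (f • Y) = f • lieBr X Y + dirDeriv X f • Y := by
  ext1 x
  rw [add_comm]
  exact VectorField.mlieBracket_smul_right (f.mdiff x) (Y.mdiff x)

end Manifold

section Koszul
variable {A L : Type*} [CommRing A] [Algebra ℝ A] [AddCommGroup L] [Module A L] [Module ℝ L]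
  [IsScalarTower ℝ A L]

/-- The value of the Koszul formula on the vectors `v 0, …, v p`:
`∑ i, (-1)^i ρ(v i) (θ(…, v̂ i, …)) + ∑ i < j, (-1)^(i+j) θ([v i, v j], …, v̂ i, …, v̂ j, …)`.
In the second sum a pair of positions `a < b` is encoded as `a = i`, `b = j + 1` with `i ≤ j`,
which accounts for its minus sign. -/
def koszulFun (ρ : L → Derivation ℝ A A) (br : L → L → L) :
    (p : ℕ) → (L [⋀^Fin p]→ₗ[A] A) → (Fin (p + 1) → L) → A
  | 0, θ, v => ρ (v 0) (θ ![])
  | p + 1, θ, v =>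
      (∑ i : Fin (p + 2), (-1 : ℤ) ^ (i : ℕ) • ρ (v i) (θ (i.removeNth v))) -
        ∑ i : Fin (p + 1), ∑ j ≥ i, (-1 : ℤ) ^ (i + j : ℕ) •
          θ (Matrix.vecCons (br (v i.castSucc) (v j.succ))
            (j.removeNth (i.castSucc.removeNth v)))

variable (ρ : L →ₗ[A] Derivation ℝ A A) (br : L →ₗ[ℝ] L →ₗ[ℝ] L)

/-- An alternating map over `A` regarded as an alternating map over `ℝ`. -/
def toReal {p : ℕ} : (L [⋀^Fin p]→ₗ[A] A) →ₗ[ℝ] (L [⋀^Fin p]→ₗ[ℝ] A) where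
  toFun θ := { θ.toMultilinearMap.restrictScalars ℝ with
    map_eq_zero_of_eq' := θ.map_eq_zero_of_eq' }
  map_add' _ _ := rfl
  map_smul' _ _ := rfl

@[simp] theorem toReal_apply {p : ℕ} (θ : L [⋀^Fin p]→ₗ[A] A) (v : Fin p → L) :
    toReal θ v = θ v := rfl

/-- First half of the Koszul formula. -/
def koszulOne {p : ℕ} (θ : L [⋀^Fin p]→ₗ[A] A) : L [⋀^Fin (p + 1)]→ₗ[ℝ] A :=
  AlternatingMap.alternatizeUncurryFin
    { toFun := fun X => (ρ X : A →ₗ[ℝ] A).compAlternatingMap (toReal θ)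
      map_add' := fun X Y => by ext v; simp
      map_smul' := fun c X => by
        ext v
        simp only [LinearMap.compAlternatingMap_apply, Derivation.coeFn_coe, RingHom.id_apply,
          AlternatingMap.smul_apply]
        rw [← algebraMap_smul A c X, map_smul, Derivation.smul_apply, algebraMap_smul] }

/-- Second half of the Koszul formula. -/
def koszulTwo {p : ℕ} (θ : L [⋀^Fin (p + 1)]→ₗ[A] A) : L [⋀^Fin (p + 2)]→ₗ[ℝ] A :=
  AlternatingMap.alternatizeUncurryFin
    (AlternatingMap.alternatizeUncurryFinLM ∘ₗ
      (br.compr₂ (AlternatingMap.curryLeft (toReal θ))))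

theorem koszulTwo_apply (hbr : ∀ X, br X X = 0) {p : ℕ} (θ : L [⋀^Fin (p + 1)]→ₗ[A] A)
    (v : Fin (p + 2) → L) :
    (1 / 2 : ℝ) • koszulTwo br θ v = ∑ i : Fin (p + 1), ∑ j ≥ i, (-1 : ℤ) ^ (i + j : ℕ) •
          θ (Matrix.vecCons (br (v i.castSucc) (v j.succ))
            (j.removeNth (i.castSucc.removeNth v))) := by
  have hanti : ∀ X Y, br Y X = - br X Y := fun X Y => by
    have := hbr (X + Y)
    simp only [map_add, LinearMap.add_apply, hbr] at this
    rw [zero_add, add_zero] at this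
    exact eq_neg_of_add_eq_zero_left this
  rw [koszulTwo, AlternatingMap.alternatizeUncurryFin_alternatizeUncurryFinLM_comp_apply,
    Finset.smul_sum]
  refine Finset.sum_congr rfl fun i _ => ?_
  rw [Finset.smul_sum]
  refine Finset.sum_congr rfl fun j _ => ?_
  rw [smul_comm]
  congr 1
  simp only [LinearMap.compr₂_apply, hanti (v i.castSucc) (v j.succ), map_neg,
    AlternatingMap.neg_apply, AlternatingMap.curryLeft_apply_apply, toReal_apply]
  rw [sub_neg_eq_add, ← two_smul ℝ, smul_smul]
  norm_num

/-- The Koszul formula as a real alternating map. -/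
def koszulReal : {p : ℕ} → (L [⋀^Fin p]→ₗ[A] A) → L [⋀^Fin (p + 1)]→ₗ[ℝ] A
  | 0, θ => koszulOne ρ θ
  | _ + 1, θ => koszulOne ρ θ - (1 / 2 : ℝ) • koszulTwo br θ

theorem koszulReal_apply (hbr : ∀ X, br X X = 0) {p : ℕ} (θ : L [⋀^Fin p]→ₗ[A] A)
    (v : Fin (p + 1) → L) :
    koszulReal ρ br θ v = koszulFun ρ (fun X Y => br X Y) p θ v := by
  cases p with
  | zero =>
    simp only [koszulReal, koszulFun, koszulOne, AlternatingMap.alternatizeUncurryFin_apply]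
    simp
    congr 2
    exact Subsingleton.elim _ _
  | succ p =>
    simp only [koszulReal, koszulFun, AlternatingMap.sub_apply, AlternatingMap.smul_apply,
      koszulTwo_apply br hbr]
    congr 1
    simp [koszulOne, AlternatingMap.alternatizeUncurryFin_apply]

theorem removeNth_update_zero {m : ℕ} (k : Fin (m + 2)) (hk : k ≠ 0) (w : Fin (m + 2) → L)
    (y : L) : k.removeNth (Function.update w 0 y) = Function.update (k.removeNth w) 0 y := by
  funext l
  simp only [Fin.removeNth_apply, Function.update_apply, Fin.succAbove_eq_zero_iff hk]

theorem vecCons_smul_eq_update {m : ℕ} (f : A) (X : L) (v : Fin m → L) :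
    Matrix.vecCons (f • X) v = Function.update (Matrix.vecCons X v) 0 (f • X) := by
  funext l
  cases l using Fin.cases <;> simp

theorem koszulFun_cons_smul (hbr : ∀ X, br X X = 0)
    (hleib : ∀ (X Y : L) (f : A), br X (f • Y) = f • br X Y + ρ X f • Y)
    {p : ℕ} (θ : L [⋀^Fin p]→ₗ[A] A) (f : A) (X : L) (v : Fin p → L) :
    koszulFun ρ (fun X Y => br X Y) p θ (Matrix.vecCons (f • X) v) =
      f * koszulFun ρ (fun X Y => br X Y) p θ (Matrix.vecCons X v) := by
  have hanti : ∀ X Y, br Y X = - br X Y := fun X Y => by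
    have := hbr (X + Y)
    simp only [map_add, LinearMap.add_apply, hbr] at this
    rw [zero_add, add_zero] at this
    exact eq_neg_of_add_eq_zero_left this
  have hleft : ∀ X Y (f : A), br (f • X) Y = f • br X Y - ρ Y f • X := fun X Y f => by
    rw [hanti Y, hleib, hanti X Y]; simp; abel
  cases p with
  | zero => simp [koszulFun]
  | succ p =>
    have h1 : ∀ i : Fin (p + 1), (ρ (v i)) (θ (i.succ.removeNth (Matrix.vecCons (f • X) v))) =
        f * ρ (v i) (θ (i.succ.removeNth (Matrix.vecCons X v))) +
          θ (Matrix.vecCons X (i.removeNth v)) * ρ (v i) f := by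
      intro i
      have e1 : ∀ Y : L, i.succ.removeNth (Matrix.vecCons Y v) =
          Matrix.vecCons Y (i.removeNth v) := by
        intro Y; funext l
        cases l using Fin.cases <;> simp [Fin.removeNth_apply]
      rw [e1, e1, vecCons_smul_eq_update, θ.map_update_smul, smul_eq_mul, Derivation.leibniz,
        Function.update_eq_self_iff.2 (by simp)]
      simp [smul_eq_mul]
    have h2 : ∀ j : Fin (p + 1), θ (Matrix.vecCons (br (f • X) (v j)) (j.removeNth v)) =
        f * θ (Matrix.vecCons (br X (v j)) (j.removeNth v)) -
          θ (Matrix.vecCons X (j.removeNth v)) * ρ (v j) f := by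
      intro j
      have e := (AlternatingMap.curryLeft θ).map_sub (f • br X (v j)) (ρ (v j) f • X)
      have e' := congrArg (fun T => T (j.removeNth v)) e
      simp only [AlternatingMap.sub_apply, map_smul, AlternatingMap.smul_apply,
        AlternatingMap.curryLeft_apply_apply, smul_eq_mul] at e'
      rw [hleft, e']; ring
    have h3 : ∀ (i : Fin p) (j : Fin (p + 1)), i.succ ≤ j → ∀ a : L,
        θ (Matrix.vecCons a (j.removeNth (i.succ.castSucc.removeNth
          (Matrix.vecCons (f • X) v)))) =
        f * θ (Matrix.vecCons a (j.removeNth (i.succ.castSucc.removeNth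
          (Matrix.vecCons X v)))) := by
      intro i j hij a
      obtain _ | p := p
      · exact i.elim0
      have hj : j ≠ 0 := by
        rintro rfl
        simp at hij
      have hi : i.succ.castSucc ≠ 0 := by simp
      rw [vecCons_smul_eq_update, removeNth_update_zero _ hi, removeNth_update_zero _ hj]
      have e2 : ∀ (u : Fin (p + 1) → L) (y : L), Matrix.vecCons a (Function.update u 0 y) =
          Function.update (Matrix.vecCons a u) 1 y := by
        intro u y; funext l
        cases l using Fin.cases with
        | zero => simp
        | succ l =>
          cases l using Fin.cases with
          | zero => simp
          | succ l => 
            rw [Matrix.cons_val_succ, Function.update_of_ne (by simp),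
              Function.update_of_ne (by exact Fin.succ_succ_ne_one l),
              Matrix.cons_val_succ]
      rw [e2, θ.map_update_smul, smul_eq_mul, Function.update_eq_self_iff.2]
      simp only [Matrix.cons_val_one, Fin.removeNth_apply]
      rw [Fin.succAbove_ne_zero_zero hj, Fin.succAbove_ne_zero_zero hi]
      simp
    have h0 : ∀ Y : L, (0 : Fin (p + 2)).removeNth (Matrix.vecCons Y v) = v := by
      intro Y; funext l; simp [Fin.removeNth_apply]
    have hh : ∀ (Y : L) (i : Fin p), Matrix.vecCons Y v i.succ.castSucc = v i.castSucc := by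
      intro Y i; rw [← Fin.succ_castSucc, Matrix.cons_val_succ]
    have hS : ∑ i : Fin p, ∑ j ≥ i.succ, (-1 : ℤ) ^ ((i.succ : ℕ) + j : ℕ) •
          θ (Matrix.vecCons (br (Matrix.vecCons (f • X) v i.succ.castSucc)
              (Matrix.vecCons (f • X) v j.succ))
            (j.removeNth (i.succ.castSucc.removeNth (Matrix.vecCons (f • X) v)))) =
        f * ∑ i : Fin p, ∑ j ≥ i.succ, (-1 : ℤ) ^ ((i.succ : ℕ) + j : ℕ) •
          θ (Matrix.vecCons (br (Matrix.vecCons X v i.succ.castSucc)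
              (Matrix.vecCons X v j.succ))
            (j.removeNth (i.succ.castSucc.removeNth (Matrix.vecCons X v)))) := by
      rw [Finset.mul_sum]
      refine Finset.sum_congr rfl fun i _ => ?_
      rw [Finset.mul_sum]
      refine Finset.sum_congr rfl fun j hj => ?_
      rw [hh, hh, Matrix.cons_val_succ, Matrix.cons_val_succ, h3 i j (Finset.mem_Ici.1 hj),
        mul_smul_comm]
    have hI : Finset.Ici (0 : Fin (p + 1)) = Finset.univ := by ext; simp
    have hE : ∀ Y : L, koszulFun ρ (fun X Y => br X Y) (p + 1) θ (Matrix.vecCons Y v) =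
        (ρ Y (θ v) + ∑ i : Fin (p + 1), (-1 : ℤ) ^ ((i : ℕ) + 1) •
          ρ (v i) (θ (i.succ.removeNth (Matrix.vecCons Y v)))) -
        (∑ j : Fin (p + 1), (-1 : ℤ) ^ (j : ℕ) •
            θ (Matrix.vecCons (br Y (v j)) (j.removeNth v)) +
          ∑ i : Fin p, ∑ j ≥ i.succ, (-1 : ℤ) ^ ((i.succ : ℕ) + j : ℕ) •
          θ (Matrix.vecCons (br (Matrix.vecCons Y v i.succ.castSucc)
              (Matrix.vecCons Y v j.succ))
            (j.removeNth (i.succ.castSucc.removeNth (Matrix.vecCons Y v))))) := by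
      intro Y
      simp only [koszulFun]
      congr 1
      · rw [Fin.sum_univ_succ]
        simp [h0]
      · rw [Fin.sum_univ_succ, hI]
        simp [h0]
    rw [hE, hE, hS]
    simp only [h1, h2, smul_sub, smul_add, Finset.sum_add_distrib, Finset.sum_sub_distrib,
      pow_succ, map_smul, Derivation.smul_apply, smul_eq_mul, mul_neg, mul_one, neg_smul,
      Finset.sum_neg_distrib, mul_sub, mul_add, Finset.mul_sum, mul_smul_comm]
    ring

theorem koszulFun_add {p : ℕ} (θ η : L [⋀^Fin p]→ₗ[A] A) (v : Fin (p + 1) → L) :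
    koszulFun ρ (fun X Y => br X Y) p (θ + η) v =
      koszulFun ρ (fun X Y => br X Y) p θ v + koszulFun ρ (fun X Y => br X Y) p η v := by
  cases p with
  | zero => simp [koszulFun]
  | succ p =>
    simp only [koszulFun, AlternatingMap.add_apply, map_add, smul_add, Finset.sum_add_distrib]
    abel

theorem koszulFun_smul {p : ℕ} (c : ℝ) (θ : L [⋀^Fin p]→ₗ[A] A) (v : Fin (p + 1) → L) :
    koszulFun ρ (fun X Y => br X Y) p (c • θ) v =
      c • koszulFun ρ (fun X Y => br X Y) p θ v := by
  cases p with
  | zero => simp [koszulFun]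
  | succ p =>
    simp only [koszulFun, AlternatingMap.smul_apply, Derivation.map_smul, smul_sub,
      Finset.smul_sum, smul_comm c]

/-- The differential of a Lie algebroid: the operator `D : Ω^p → Ω^(p+1)` given by the Koszul
formula `koszulFun`. -/
def koszul (hbr : ∀ X, br X X = 0)
    (hleib : ∀ (X Y : L) (f : A), br X (f • Y) = f • br X Y + ρ X f • Y) (p : ℕ) :
    (L [⋀^Fin p]→ₗ[A] A) →ₗ[ℝ] (L [⋀^Fin (p + 1)]→ₗ[A] A) where
  toFun θ :=
    { toFun := koszulFun ρ (fun X Y => br X Y) p θ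
      map_update_add' := by
        intro dec v i X Y
        have := (koszulReal ρ br θ).map_update_add v i X Y
        simp only [koszulReal_apply ρ br hbr] at this
        convert! this
      map_update_smul' := by
        intro dec v i f X
        obtain rfl : dec = instDecidableEqFin (p + 1) := Subsingleton.elim _ _
        have key : ∀ Y : L, koszulFun ρ (fun X Y => br X Y) p θ (Function.update v i Y) =
            (-1 : ℤ) ^ (i : ℕ) • koszulFun ρ (fun X Y => br X Y) p θ
              (Matrix.vecCons Y (i.removeNth v)) := by
          intro Y
          simp only [← koszulReal_apply ρ br hbr]
          rw [← Fin.insertNth_removeNth, AlternatingMap.map_insertNth]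
        rw [key, key, koszulFun_cons_smul ρ br hbr hleib, smul_eq_mul, mul_smul_comm]
      map_eq_zero_of_eq' := by
        intro v i j h hij
        rw [← koszulReal_apply ρ br hbr]
        exact (koszulReal ρ br θ).map_eq_zero_of_eq v h hij }
  map_add' θ η := by
    ext v : 1
    exact koszulFun_add ρ br θ η v
  map_smul' c θ := by
    ext v : 1
    exact koszulFun_smul ρ br c θ v

@[simp] theorem koszul_apply (hbr : ∀ X, br X X = 0)
    (hleib : ∀ (X Y : L) (f : A), br X (f • Y) = f • br X Y + ρ X f • Y) (p : ℕ)
    (θ : L [⋀^Fin p]→ₗ[A] A) (v : Fin (p + 1) → L) :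
    koszul ρ br hbr hleib p θ v = koszulFun ρ (fun X Y => br X Y) p θ v := rfl

end Koszul

section Algebroid

variable {n : ℕ} {M : Type*} [TopologicalSpace M] [ChartedSpace (EuclideanSpace ℝ (Fin n)) M]
  [IsManifold (𝓡 n) ∞ M]

/-- A Lie algebroid structure on a vector bundle `E` over `M`, expressed on the `C^∞(M)`-module
`L = Γ(E)` of its smooth sections: an anchor (a bundle map `E → TM` over `M`, that is, a
`C^∞(M)`-linear map `Γ(E) → Γ(TM)`), and a Lie bracket on `Γ(E)` satisfying the Leibniz rule. -/
@[ext] structure LieAlgebroid (n : ℕ) (M : Type*) [TopologicalSpace M]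
    [ChartedSpace (EuclideanSpace ℝ (Fin n)) M] [IsManifold (𝓡 n) ∞ M]
    (L : Type*) [AddCommGroup L] [Module (Fun n M) L] [Module ℝ L] where
  /-- The anchor. -/
  anchor : L →ₗ[Fun n M] VF n M
  /-- The bracket. -/
  bracket : L →ₗ[ℝ] L →ₗ[ℝ] L
  bracket_self : ∀ X, bracket X X = 0
  jacobi : ∀ X Y Z,
    bracket X (bracket Y Z) = bracket (bracket X Y) Z + bracket Y (bracket X Z)
  leibniz : ∀ (X Y : L) (f : Fun n M),
    bracket X (f • Y) = f • bracket X Y + dirDeriv (anchor X) f • Y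

variable {L : Type*} [AddCommGroup L] [Module (Fun n M) L] [Module ℝ L]
  [IsScalarTower ℝ (Fun n M) L]

/-- For `L = Γ(E)`, the smooth sections of `Λ^p E^*`, as the `C^∞(M)`-multilinear alternating maps
`Γ(E)^p → C^∞(M)`. -/
abbrev Form (n : ℕ) (M : Type*) [TopologicalSpace M]
    [ChartedSpace (EuclideanSpace ℝ (Fin n)) M] [IsManifold (𝓡 n) ∞ M]
    (L : Type*) [AddCommGroup L] [Module (Fun n M) L] (p : ℕ) :=
  L [⋀^Fin p]→ₗ[Fun n M] (Fun n M)

/-- A smooth function as a form of degree `0`. -/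
abbrev Form.ofFun (f : Fun n M) : Form n M L 0 :=
  AlternatingMap.constOfIsEmpty (Fun n M) L (Fin 0) f

/-- The wedge product of forms (with the sum over shuffles). -/
def Form.wedge {p r : ℕ} (α : Form n M L p) (β : Form n M L r) : Form n M L (p + r) :=
  ((LinearMap.mul' (Fun n M) (Fun n M)).compAlternatingMap (α.domCoprod β)).domDomCongr
    finSumFinEquiv

/-- Transport of a form along an equality of degrees. -/
def Form.cast {p r : ℕ} (h : p = r) (α : Form n M L p) : Form n M L r :=
  α.domDomCongr (finCongr h)

namespace LieAlgebroid

/-- The differential `D : Γ(Λ^p E^*) → Γ(Λ^(p+1) E^*)` of a Lie algebroid. -/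
def differential (𝓐 : LieAlgebroid n M L) (p : ℕ) : Form n M L p →ₗ[ℝ] Form n M L (p + 1) :=
  koszul (dirDeriv ∘ₗ 𝓐.anchor) 𝓐.bracket 𝓐.bracket_self 𝓐.leibniz p

theorem differential_apply (𝓐 : LieAlgebroid n M L) (p : ℕ) (θ : Form n M L p)
    (v : Fin (p + 1) → L) : 𝓐.differential p θ v =
      koszulFun (fun X => dirDeriv (𝓐.anchor X)) (fun X Y => 𝓐.bracket X Y) p θ v := rfl

/-- `D` is the operator associated to the Lie algebroid: `Df(X) = q(X) f`,
`Dα(X, Y) = q(X) (α(Y)) - q(Y) (α(X)) - α([X, Y])`, and `D` is a derivation of degree `1`. -/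
structure IsAssociatedOperator (𝓐 : LieAlgebroid n M L)
    (D : ∀ p, Form n M L p →ₗ[ℝ] Form n M L (p + 1)) : Prop where
  on_functions : ∀ (f : Fun n M) (X : L),
    D 0 (Form.ofFun f) ![X] = dirDeriv (𝓐.anchor X) f
  on_one_forms : ∀ (α : Form n M L 1) (X Y : L),
    D 1 α ![X, Y] = dirDeriv (𝓐.anchor X) (α ![Y]) - dirDeriv (𝓐.anchor Y) (α ![X])
      - α ![𝓐.bracket X Y]
  derivation : ∀ (p r : ℕ) (α : Form n M L p) (β : Form n M L r),
    D (p + r) (α.wedge β) =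
      Form.cast (by omega) ((D p α).wedge β) + (-1 : ℝ) ^ p • α.wedge (D r β)

/-- The restriction of a Lie algebroid to a submodule `S` of sections (the sections of a
subbundle) that is closed under the bracket. -/
def restrict (𝓐 : LieAlgebroid n M L) (S : Submodule (Fun n M) L)
    (hS : ∀ X ∈ S, ∀ Y ∈ S, 𝓐.bracket X Y ∈ S) : LieAlgebroid n M S where
  anchor := 𝓐.anchor ∘ₗ S.subtype
  bracket := LinearMap.mk₂ ℝ (fun X Y => ⟨𝓐.bracket X Y, hS X X.2 Y Y.2⟩)
    (fun X X' Y => Subtype.ext (by simp)) (fun c X Y => Subtype.ext (by simp))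
    (fun X Y Y' => Subtype.ext (by simp)) (fun c X Y => Subtype.ext (by simp))
  bracket_self X := Subtype.ext (𝓐.bracket_self X)
  jacobi X Y Z := Subtype.ext (𝓐.jacobi X Y Z)
  leibniz X Y f := Subtype.ext (𝓐.leibniz X Y f)

end LieAlgebroid

variable (n M) in
/-- The tangent Lie algebroid `(TM, Id, [·, ·])`. -/
def tangentAlgebroid : LieAlgebroid n M (VF n M) where
  anchor := LinearMap.id
  bracket := lieBr
  bracket_self := lieBr_self
  jacobi := lieBr_jacobi
  leibniz := lieBr_leibniz

variable (n M) in
/-- The exterior differential `d` of `M`, i.e. the differential of the tangent Lie algebroid. -/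
abbrev extD (p : ℕ) : Form n M (VF n M) p →ₗ[ℝ] Form n M (VF n M) (p + 1) :=
  (tangentAlgebroid n M).differential p

end Algebroid

section Foliation

variable {n : ℕ} {M : Type*} [TopologicalSpace M] [ChartedSpace (EuclideanSpace ℝ (Fin n)) M]
  [IsManifold (𝓡 n) ∞ M]

/-- A regular foliation of `M`, given by its tangent distribution `TF ⊆ TM`: around every point
there is a flat (foliated) chart `φ` of `M`, which carries `TF` to the constant distribution of a
fixed linear subspace `W` of the model space. The plaques of the foliation in such a chart are the
slices of `φ` parallel to `W`. The rank is only required to be locally constant. -/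
structure RegularFoliation (n : ℕ) (M : Type*) [TopologicalSpace M]
    [ChartedSpace (EuclideanSpace ℝ (Fin n)) M] [IsManifold (𝓡 n) ∞ M] where
  /-- The tangent spaces `T_x F`. -/
  tangent : ∀ x : M, Submodule ℝ (TangentSpace (𝓡 n) x)
  exists_flat_chart : ∀ x : M, ∃ φ ∈ IsManifold.maximalAtlas (𝓡 n) ∞ M, x ∈ φ.source ∧
    ∃ W : Submodule ℝ (EuclideanSpace ℝ (Fin n)), ∀ y ∈ φ.source, ∀ v : TangentSpace (𝓡 n) y,
      v ∈ tangent y ↔ mfderiv (𝓡 n) (𝓡 n) φ y v ∈ W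

theorem fderiv_mem_of_eventually_mem {E : Type*} [NormedAddCommGroup E] [InnerProductSpace ℝ E]
    [FiniteDimensional ℝ E] (W : Submodule ℝ E) (g : E → E) (e : E)
    (hg : ∀ᶠ z in nhds e, g z ∈ W) (v : E) : fderivWithin ℝ g Set.univ e v ∈ W := by
  rw [fderivWithin_univ]
  by_cases hd : DifferentiableAt ℝ g e
  · have h1 : g =ᶠ[nhds e] fun z => W.starProjection (g z) := by
      filter_upwards [hg] with z hz
      exact (W.starProjection_eq_self_iff.2 hz).symm
    rw [h1.fderiv_eq]
    have h2 : fderiv ℝ (fun z => W.starProjection (g z)) e = W.starProjection ∘L fderiv ℝ g e :=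
      (W.starProjection.hasFDerivAt.comp e hd.hasFDerivAt).fderiv
    rw [h2]
    exact W.starProjection_apply_mem _
  · rw [fderiv_zero_of_not_differentiableAt hd]
    exact W.zero_mem

/-- The vector fields tangent to a foliation are closed under the Lie bracket. -/
theorem RegularFoliation.lieBr_mem (F : RegularFoliation n M) {X Y : VF n M}
    (hX : ∀ x, X x ∈ F.tangent x) (hY : ∀ x, Y x ∈ F.tangent x) (x : M) :
    lieBr X Y x ∈ F.tangent x := by
  obtain ⟨φ, hφ, hx, W, hW⟩ := F.exists_flat_chart x
  rw [hW x hx, lieBr_apply]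
  have i2 : IsManifold (𝓡 n) (minSmoothness ℝ 2) M :=
    IsManifold.of_le (n := ∞) (by simp; exact ENat.LEInfty.out)
  have hcφ := contMDiffOn_of_mem_maximalAtlas hφ
  have hcs := contMDiffOn_symm_of_mem_maximalAtlas hφ
  have hmd : φ.MDifferentiable (𝓡 n) (𝓡 n) :=
    ⟨hcφ.mdifferentiableOn (by simp), hcs.mdifferentiableOn (by simp)⟩
  have hinv : ∀ e ∈ φ.target, (mfderiv (𝓡 n) (𝓡 n) φ.symm e).inverse =
      mfderiv (𝓡 n) (𝓡 n) φ (φ.symm e) := by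
    intro e he
    refine ContinuousLinearMap.inverse_eq ?_ ?_
    · have := hmd.symm_comp_deriv (φ.map_target he)
      rwa [φ.right_inv he] at this
    · exact hmd.comp_symm_deriv he
  have hpull : ∀ Z : VF n M, (∀ x, Z x ∈ F.tangent x) → ∀ᶠ e in nhds (φ x),
      VectorField.mpullback (𝓡 n) (𝓡 n) φ.symm Z e ∈ W := by
    intro Z hZ
    filter_upwards [φ.open_target.mem_nhds (φ.map_source hx)] with e he
    rw [VectorField.mpullback_apply, hinv e he]
    exact (hW _ (φ.map_target he) _).1 (hZ _)
  have key := VectorField.mpullback_mlieBracket (I := 𝓡 n) (I' := 𝓡 n) (f := φ.symm)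
    (x₀ := φ x) (V := X) (W := Y) (n := ∞) (X.mdiff _) (Y.mdiff _)
    (hcs.contMDiffAt (φ.open_target.mem_nhds (φ.map_source hx))) (by simp; exact ENat.LEInfty.out)
  rw [VectorField.mpullback_apply, hinv _ (φ.map_source hx), φ.left_inv hx] at key
  have h1 := fderiv_mem_of_eventually_mem W _ _ (hpull Y hY)
    (VectorField.mpullback (𝓡 n) (𝓡 n) φ.symm X (φ x))
  have h2 := fderiv_mem_of_eventually_mem W _ _ (hpull X hX)
    (VectorField.mpullback (𝓡 n) (𝓡 n) φ.symm Y (φ x))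
  rw [key, ← VectorField.mlieBracketWithin_univ,
    VectorField.mlieBracketWithin_eq_lieBracketWithin]
  exact W.sub_mem h1 h2

namespace RegularFoliation

variable (F : RegularFoliation n M)

/-- The module `Γ(TF)` of smooth vector fields tangent to the foliation. -/
def sections : Submodule (Fun n M) (VF n M) where
  carrier := {X | ∀ x, X x ∈ F.tangent x}
  add_mem' hX hY x := (F.tangent x).add_mem (hX x) (hY x)
  zero_mem' x := (F.tangent x).zero_mem
  smul_mem' f _ hX x := (F.tangent x).smul_mem (f x) (hX x)

/-- The Lie algebroid of the foliation: the bundle `TF` with the restriction of the Lie bracket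
and the inclusion `TF → TM` as anchor. -/
def algebroid : LieAlgebroid n M F.sections where
  anchor := F.sections.subtype
  bracket := LinearMap.mk₂ ℝ (fun X Y => ⟨lieBr (X : VF n M) Y, F.lieBr_mem X.2 Y.2⟩)
    (fun X X' Y => Subtype.ext (by simp)) (fun c X Y => Subtype.ext (by simp))
    (fun X Y Y' => Subtype.ext (by simp)) (fun c X Y => Subtype.ext (by simp))
  bracket_self X := Subtype.ext (lieBr_self (X : VF n M))
  jacobi X Y Z := Subtype.ext (lieBr_jacobi (X : VF n M) Y Z)
  leibniz X Y f := Subtype.ext (lieBr_leibniz (X : VF n M) Y f)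

/-- The foliated exterior differential `d_F : Γ(Λ^p T^*F) → Γ(Λ^(p+1) T^*F)`. -/
abbrev foliatedD (p : ℕ) : Form n M F.sections p →ₗ[ℝ] Form n M F.sections (p + 1) :=
  F.algebroid.differential p

end RegularFoliation

/-- An Ehresmann connection complementary to the foliation `F`, given by the associated smooth
projection `γ` of `TM` onto `TF`, a vector-valued 1-form; the horizontal bundle is `H = ker γ`. -/
structure EhresmannConnection (F : RegularFoliation n M) where
  /-- The projection, as a smooth section of the bundle `End(TM)`. -/
  γ : Cₛ^∞⟮𝓡 n; EuclideanSpace ℝ (Fin n) →L[ℝ] EuclideanSpace ℝ (Fin n),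
    (fun x : M => TangentSpace (𝓡 n) x →L[ℝ] TangentSpace (𝓡 n) x)⟯
  idem : ∀ (x : M) (v : TangentSpace (𝓡 n) x), γ x (γ x v) = γ x v
  range_eq : ∀ x : M, (γ x).range = F.tangent x

namespace EhresmannConnection

variable {F : RegularFoliation n M} (c : EhresmannConnection F)

/-- The action of `γ` on vector fields. -/
def proj : VF n M →ₗ[Fun n M] VF n M where
  toFun X := ⟨fun x => c.γ x (X x), c.γ.contMDiff.clm_bundle_apply X.contMDiff⟩
  map_add' X Y := by ext1 x; exact map_add (c.γ x) (X x) (Y x)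
  map_smul' f X := by ext1 x; exact map_smul (c.γ x) (f x) (X x)

theorem proj_mem (X : VF n M) : c.proj X ∈ F.sections := fun x => by
  rw [← c.range_eq x]; exact ⟨X x, rfl⟩

theorem proj_proj (X : VF n M) : c.proj (c.proj X) = c.proj X := by
  ext1 x; exact c.idem x (X x)

theorem proj_of_mem {X : VF n M} (hX : X ∈ F.sections) : c.proj X = X := by
  ext1 x
  have h : X x ∈ (c.γ x).range := by rw [c.range_eq x]; exact hX x
  obtain ⟨v, hv⟩ := h
  change c.γ x (X x) = X x
  rw [← hv]
  exact c.idem x v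

/-- The module `Γ(H)` of horizontal vector fields. -/
def horizontal : Submodule (Fun n M) (VF n M) := LinearMap.ker c.proj

/-- `γ` as a map `Γ(TM) → Γ(TF)`. -/
def projF : VF n M →ₗ[Fun n M] F.sections := c.proj.codRestrict F.sections c.proj_mem

/-- The contracted bracket `[X, Y]_γ = [γX, Y] + [X, γY] - γ[X, Y]`. -/
def contractedBr (X Y : VF n M) : VF n M :=
  lieBr (c.proj X) Y + lieBr X (c.proj Y) - c.proj (lieBr X Y)

/-- The Nijenhuis torsion `T_γ(X, Y) = [γX, γY] - γ[γX, Y] - γ[X, γY] + γ²[X, Y]`. -/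
def torsion (X Y : VF n M) : VF n M :=
  lieBr (c.proj X) (c.proj Y) - c.proj (lieBr (c.proj X) Y) - c.proj (lieBr X (c.proj Y))
    + c.proj (c.proj (lieBr X Y))

theorem contractedBr_add_torsion (X Y : VF n M) :
    c.contractedBr X Y + c.torsion X Y = lieBr (c.proj X) (c.proj Y)
      + ((lieBr (c.proj X) Y + lieBr X (c.proj Y))
        - c.proj (lieBr (c.proj X) Y + lieBr X (c.proj Y))) := by
  simp only [contractedBr, torsion, c.proj_proj, map_add]
  abel

theorem proj_lieBr (X Y : VF n M) :
    c.proj (lieBr (c.proj X) (c.proj Y)) = lieBr (c.proj X) (c.proj Y) :=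
  c.proj_of_mem (F.lieBr_mem (c.proj_mem X) (c.proj_mem Y))

theorem proj_real_smul (r : ℝ) (X : VF n M) : c.proj (r • X) = r • c.proj X :=
  LinearMap.map_smul_of_tower _ _ _

/-- The bracket `[X, Y]_γ + T_γ(X, Y)` on vector fields. -/
def bracket : VF n M →ₗ[ℝ] VF n M →ₗ[ℝ] VF n M :=
  LinearMap.mk₂ ℝ (fun X Y => c.contractedBr X Y + c.torsion X Y)
    (fun X X' Y => by
      simp only [contractedBr_add_torsion, map_add, LinearMap.add_apply]; abel)
    (fun r X Y => by
      simp only [contractedBr_add_torsion, map_add, proj_real_smul, map_smul,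
        LinearMap.smul_apply, smul_add, smul_sub])
    (fun X Y Y' => by
      simp only [contractedBr_add_torsion, map_add]; abel)
    (fun r X Y => by
      simp only [contractedBr_add_torsion, map_add, proj_real_smul, map_smul, smul_add,
        smul_sub])

theorem bracket_apply (X Y : VF n M) : c.bracket X Y = c.contractedBr X Y + c.torsion X Y := rfl

theorem bracket_eq (X Y : VF n M) :
    c.bracket X Y = lieBr (c.proj X) (c.proj Y)
      + ((lieBr (c.proj X) Y + lieBr X (c.proj Y))
        - c.proj (lieBr (c.proj X) Y + lieBr X (c.proj Y))) :=
  c.contractedBr_add_torsion X Y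

theorem proj_bracket (X Y : VF n M) :
    c.proj (c.bracket X Y) = lieBr (c.proj X) (c.proj Y) := by
  rw [bracket_eq, map_add, map_sub, proj_proj, sub_self, add_zero, proj_lieBr]

theorem lieBr_swap (X Y : VF n M) : lieBr Y X = - lieBr X Y := by
  have := lieBr_self (X + Y)
  simp only [map_add, LinearMap.add_apply, lieBr_self] at this
  rw [zero_add, add_zero] at this
  exact eq_neg_of_add_eq_zero_left this

theorem bracket_self (X : VF n M) : c.bracket X X = 0 := by
  rw [bracket_eq, lieBr_self, lieBr_swap X (c.proj X), neg_add_cancel]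
  simp

theorem bracket_bracket (X Y Z : VF n M) :
    c.bracket X (c.bracket Y Z) = lieBr (c.proj X) (lieBr (c.proj Y) (c.proj Z)) +
      ((lieBr (c.proj X) (lieBr (c.proj Y) Z) + lieBr (c.proj X) (lieBr Y (c.proj Z)) +
          lieBr X (lieBr (c.proj Y) (c.proj Z))) -
        c.proj (lieBr (c.proj X) (lieBr (c.proj Y) Z) + lieBr (c.proj X) (lieBr Y (c.proj Z)) +
          lieBr X (lieBr (c.proj Y) (c.proj Z)))) := by
  have h1 : c.proj (lieBr (c.proj X) (lieBr (c.proj Y) (c.proj Z))) =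
      lieBr (c.proj X) (lieBr (c.proj Y) (c.proj Z)) := by
    rw [← c.proj_lieBr Y Z, proj_lieBr]
  have h2 := c.proj_lieBr X (lieBr (c.proj Y) Z)
  have h3 := c.proj_lieBr X (lieBr Y (c.proj Z))
  rw [bracket_eq c X, proj_bracket, bracket_eq c Y Z]
  simp only [map_add, map_sub, h1, h2, h3]
  abel

theorem bracket_swap (X Y : VF n M) : c.bracket Y X = - c.bracket X Y := by
  have := c.bracket_self (X + Y)
  simp only [map_add, LinearMap.add_apply, bracket_self] at this
  rw [zero_add, add_zero] at this
  exact eq_neg_of_add_eq_zero_left this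

theorem lieBr_jacobi' (X Y Z : VF n M) :
    lieBr X (lieBr Y Z) = - lieBr Z (lieBr X Y) + lieBr Y (lieBr X Z) := by
  rw [lieBr_jacobi X Y Z, lieBr_swap Z (lieBr X Y)]

theorem bracket_jacobi (X Y Z : VF n M) :
    c.bracket X (c.bracket Y Z) = c.bracket (c.bracket X Y) Z + c.bracket Y (c.bracket X Z) := by
  rw [c.bracket_swap Z (c.bracket X Y), bracket_bracket, bracket_bracket, bracket_bracket,
    lieBr_jacobi' (c.proj X) (c.proj Y) (c.proj Z), lieBr_jacobi' (c.proj X) (c.proj Y) Z,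
    lieBr_jacobi' (c.proj X) Y (c.proj Z), lieBr_jacobi' X (c.proj Y) (c.proj Z)]
  simp only [map_add, map_neg]
  abel

theorem bracket_leibniz (X Y : VF n M) (f : Fun n M) :
    c.bracket X (f • Y) = f • c.bracket X Y + dirDeriv (c.proj X) f • Y := by
  simp only [bracket_eq, map_smul, lieBr_leibniz, map_add, smul_add, smul_sub, proj_proj]
  abel

/-- The Lie algebroid on `TM` with anchor `γ` and bracket `[X, Y]_γ + T_γ(X, Y)`. -/
def algebroid : LieAlgebroid n M (VF n M) where
  anchor := c.proj
  bracket := c.bracket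
  bracket_self := c.bracket_self
  jacobi := c.bracket_jacobi
  leibniz := c.bracket_leibniz

/-- A form is of type `(a, b)` if it has degree `a + b` and vanishes whenever more than `b` of
its arguments lie in `Γ(TF)`, or more than `a` lie in `Γ(H)`. -/
def IsOfType {p : ℕ} (a b : ℤ) (θ : Form n M (VF n M) p) : Prop :=
  a + b = p ∧ ∀ (v : Fin p → VF n M) (S : Finset (Fin p)),
    ((∀ i ∈ S, v i ∈ F.sections) → b < S.card → θ v = 0) ∧
    ((∀ i ∈ S, v i ∈ c.horizontal) → a < S.card → θ v = 0)

/-- `γ` for positions in `S`, `Id - γ` for the others. -/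
def sel {p : ℕ} (S : Finset (Fin p)) (i : Fin p) : VF n M →ₗ[Fun n M] VF n M :=
  if i ∈ S then c.proj else LinearMap.id - c.proj

/-- The component of type `(p - b, b)` of a form of degree `p`: the sum, over all sets `S` of `b`
positions, of the forms obtained by inserting the `TF`-parts of the arguments in the positions
in `S` and the `H`-parts of the arguments in the other positions. -/
def typePart (b : ℤ) {p : ℕ} (θ : Form n M (VF n M) p) : Form n M (VF n M) p where
  toMultilinearMap := ∑ S : Finset (Fin p) with (S.card : ℤ) = b,
    θ.toMultilinearMap.compLinearMap (c.sel S)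
  map_eq_zero_of_eq' := by
    intro v i j hv hij
    have hsel : ∀ (S : Finset (Fin p)) (k : Fin p),
        c.sel (S.map (Equiv.swap i j).toEmbedding) k = c.sel S (Equiv.swap i j k) := by
      intro S k
      simp [sel, Finset.mem_map_equiv]
    have hvs : ∀ k, v (Equiv.swap i j k) = v k := by
      intro k
      rcases eq_or_ne k i with rfl | hki
      · simp [hv]
      rcases eq_or_ne k j with rfl | hkj
      · simp [hv]
      · rw [Equiv.swap_apply_of_ne_of_ne hki hkj]
    have happ : ∀ u : Fin p → VF n M,
        (∑ S : Finset (Fin p) with (S.card : ℤ) = b,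
          θ.toMultilinearMap.compLinearMap (c.sel S)) u =
        ∑ S : Finset (Fin p) with (S.card : ℤ) = b, θ fun k => c.sel S k (u k) := by
      intro u
      simp
    have hsum : ∀ S : Finset (Fin p),
        (θ fun k => c.sel (S.map (Equiv.swap i j).toEmbedding) k (v k)) =
          - θ fun k => c.sel S k (v k) := by
      intro S
      have h1 := θ.map_swap (fun k => c.sel S k (v k)) hij
      rw [← h1]
      congr 1
      funext k
      rw [hsel, Function.comp_apply, hvs]
    refine (happ v).trans (Finset.sum_involution
      (fun S _ => S.map (Equiv.swap i j).toEmbedding) ?_ ?_ ?_ ?_)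
    · intro S _
      rw [hsum, add_neg_cancel]
    · intro S _ hne heq
      apply hne
      refine θ.map_eq_zero_of_eq _ ?_ hij
      have h2 := hsel S i
      rw [heq, Equiv.swap_apply_left] at h2
      simp only [h2, hv]
    · intro S hS
      simpa using hS
    · intro S _
      ext k
      simp [Finset.mem_map_equiv]

theorem typePart_apply (b : ℤ) {p : ℕ} (θ : Form n M (VF n M) p) (v : Fin p → VF n M) :
    c.typePart b θ v =
      ∑ S : Finset (Fin p) with (S.card : ℤ) = b, θ fun i => c.sel S i (v i) := by
  change (∑ S : Finset (Fin p) with (S.card : ℤ) = b,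
    θ.toMultilinearMap.compLinearMap (c.sel S)) v = _
  simp

/-- `typePart` as a linear map. -/
def typePartL (b : ℤ) (p : ℕ) : Form n M (VF n M) p →ₗ[ℝ] Form n M (VF n M) p where
  toFun := c.typePart b
  map_add' θ η := by ext v : 1; simp [typePart_apply, Finset.sum_add_distrib]
  map_smul' r θ := by ext v : 1; simp [typePart_apply, Finset.smul_sum]

/-- The component `d_{1-j,j}` of the exterior differential, which maps forms of type `(a, b)` to
forms of type `(a + 1 - j, b + j)`: the sum over `b` of the composites
`Ω^p → Ω^{p-b,b} → Ω^{p+1} → Ω^{p+1-b-j,b+j}` of the projections with `d`. -/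
def dComponent (j : ℤ) (p : ℕ) : Form n M (VF n M) p →ₗ[ℝ] Form n M (VF n M) (p + 1) :=
  ∑ b ∈ Finset.range (p + 1), c.typePartL (b + j) (p + 1) ∘ₗ extD n M p ∘ₗ c.typePartL b p

/-- The component `d_{0,1}` of the exterior differential. -/
abbrev d01 (p : ℕ) : Form n M (VF n M) p →ₗ[ℝ] Form n M (VF n M) (p + 1) := c.dComponent 1 p

/-- The component `d_{1,0}` of the exterior differential. -/
abbrev d10 (p : ℕ) : Form n M (VF n M) p →ₗ[ℝ] Form n M (VF n M) (p + 1) := c.dComponent 0 p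

/-- The component `d_{2,-1}` of the exterior differential. -/
abbrev d2m1 (p : ℕ) : Form n M (VF n M) p →ₗ[ℝ] Form n M (VF n M) (p + 1) := c.dComponent (-1) p

/-- `Γ(Λ^p H⁰)`, where `H⁰ ⊆ T^*M` is the annihilator of `H`: the forms which vanish as soon as
one of the arguments is horizontal. -/
def annForms (p : ℕ) : Submodule (Fun n M) (Form n M (VF n M) p) where
  carrier := {θ | ∀ v : Fin p → VF n M, (∃ i, v i ∈ c.horizontal) → θ v = 0}
  add_mem' hθ hη v hv := by simp [hθ v hv, hη v hv]
  zero_mem' v _ := rfl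
  smul_mem' f θ hθ v hv := by simp [hθ v hv]

end EhresmannConnection

end Foliation

end FoliatedAlgebroid

end

open FoliatedAlgebroid

noncomputable section

namespace FoliatedAlgebroid

/-! ### Cartan calculus for the Koszul operator, and `D² = 0`. -/

section Cartan

variable {A L : Type*} [CommRing A] [AddCommGroup L] [Module A L]

/-! The algebraic half is Cartan calculus, valid for any anchor and bracket. Expanding the Koszul
formula in its first argument (`koszulFun_cons`) shows that `L_X = i_X D + D i_X` acts by `X(θ(v)) -
∑ θ(…, [X, v_j], …)`, a formula free of `D`. From it come `[L_X, i_Z] = i_[X,Z]`, `[L_X, L_Y] =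
L_[X,Y]` and `[L_X, D] = 0`, and then `D² = 0` and the Leibniz rule for `∧`, each by induction on
the degree after contracting with a vector. `D² = 0` also needs the anchor to preserve brackets: for
`γ` this is `γ⟦X, Y⟧ = [γX, γY]` (`proj_bracket`), combined with the fact that the Lie bracket acts
on functions as a commutator (`dirDeriv_lieBr`).

The geometric half is a count of vertical arguments. As `TM = H ⊕ TF`, a form is determined by its
values on pure tuples, whose entries are each in `Γ(TF)` or in `Γ(H)`, and it is a sum of forms of
fibre degree `b`, supported on the pure tuples with exactly `b` entries in `Γ(TF)`. On pure pairs
`⟦X, Y⟧` is `0` for two horizontal fields, `[X, Y]` for two vertical ones, and the horizontal part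
of `[X, Y]` for a mixed pair. Hence `D` raises the fibre degree by exactly one
(`hasFibreDegree_differential`), and on tuples with `b + 1` vertical entries the terms in which `D`
and `d` differ vanish (`differential_apply_eq_extD`). So `D = d_{0,1}`. The same count, with the
involutivity of `TF`, leaves only the three components of `d`.

The annihilator forms are those of top fibre degree, so `D` preserves them. Since `γ` respects
brackets and anchors, pulling back along it matches the two Koszul formulas term by term. -/

/-- This drives the inductions on the degree: an identity of forms is checked after contraction, one
degree lower. -/
theorem alternating_ext_curryLeft {p : ℕ} {θ η : L [⋀^Fin (p + 1)]→ₗ[A] A}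
    (h : ∀ X, θ.curryLeft X = η.curryLeft X) : θ = η := by
  ext v
  have := congrArg (fun T => T (Matrix.vecTail v)) (h (Matrix.vecHead v))
  simpa only [AlternatingMap.curryLeft_apply_apply, Matrix.cons_head_tail] using this

theorem alternating_cons_removeNth {p : ℕ} (θ : L [⋀^Fin (p + 1)]→ₗ[A] A) (v : Fin (p + 1) → L)
    (i : Fin (p + 1)) (Y : L) : (-1 : ℤ) ^ (i : ℕ) • θ (Matrix.vecCons Y (i.removeNth v)) =
      θ (Function.update v i Y) := by
  rw [← Fin.insertNth_removeNth, θ.map_insertNth]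

theorem removeNth_succ_vecCons {p : ℕ} (i : Fin (p + 1)) (X : L) (v : Fin (p + 1) → L) :
    i.succ.removeNth (Matrix.vecCons X v) = Matrix.vecCons X (i.removeNth v) := by
  funext l
  cases l using Fin.cases <;> simp [Fin.removeNth_apply]

theorem removeNth_zero_vecCons {p : ℕ} (X : L) (v : Fin p → L) :
    (0 : Fin (p + 1)).removeNth (Matrix.vecCons X v) = v := by
  funext l
  simp [Fin.removeNth_apply]

theorem alternating_cons_cons_swap {p : ℕ} (θ : L [⋀^Fin (p + 2)]→ₗ[A] A) (X Y : L)
    (v : Fin p → L) :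
    θ (Matrix.vecCons X (Matrix.vecCons Y v)) = - θ (Matrix.vecCons Y (Matrix.vecCons X v)) := by
  have h : (0 : Fin (p + 2)) ≠ 1 := by simp
  rw [← θ.map_swap _ h]
  congr 1
  funext l
  cases l using Fin.cases with
  | zero => simp
  | succ l =>
    cases l using Fin.cases with
    | zero => simp
    | succ l =>
      rw [Function.comp_apply, Equiv.swap_apply_of_ne_of_ne (by simp)
        (Fin.succ_succ_ne_one l)]
      simp

variable [Algebra ℝ A] [Module ℝ L] [IsScalarTower ℝ A L]
  (ρ : L →ₗ[A] Derivation ℝ A A) (br : L →ₗ[ℝ] L →ₗ[ℝ] L)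

/-- Separates the terms in which `X` is differentiated along or bracketed from those in which `X`
stays an argument of `θ`. The latter form the Koszul formula of `i_X θ`, with the opposite sign. -/
theorem koszulFun_cons {p : ℕ} (θ : L [⋀^Fin (p + 1)]→ₗ[A] A) (X : L) (v : Fin (p + 1) → L) :
    koszulFun ρ (fun X Y => br X Y) (p + 1) θ (Matrix.vecCons X v) =
      ρ X (θ v) - ∑ j : Fin (p + 1), θ (Function.update v j (br X (v j))) -
        koszulFun ρ (fun X Y => br X Y) p (θ.curryLeft X) v := by
  have h0 : ∀ j : Fin (p + 1), (-1 : ℤ) ^ (j : ℕ) •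
      θ (Matrix.vecCons (br X (v j)) (j.removeNth v)) =
        θ (Function.update v j (br X (v j))) := by
    intro j
    exact alternating_cons_removeNth θ v j _
  have hI : Finset.Ici (0 : Fin (p + 1)) = Finset.univ := by ext; simp
  have e : koszulFun ρ (fun X Y => br X Y) (p + 1) θ (Matrix.vecCons X v) =
        (ρ X (θ v) + ∑ i : Fin (p + 1), (-1 : ℤ) ^ ((i : ℕ) + 1) •
          ρ (v i) (θ (Matrix.vecCons X (i.removeNth v)))) -
        (∑ j : Fin (p + 1), θ (Function.update v j (br X (v j))) +
          ∑ i : Fin p, ∑ j ≥ i.succ, (-1 : ℤ) ^ ((i : ℕ) + 1 + j : ℕ) •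
          θ (Matrix.vecCons (br (v i.castSucc) (v j))
            (j.removeNth (i.succ.castSucc.removeNth (Matrix.vecCons X v))))) := by
    simp only [koszulFun]
    congr 1
    · rw [Fin.sum_univ_succ]
      simp [removeNth_succ_vecCons]
    · rw [Fin.sum_univ_succ, hI]
      simp only [Fin.castSucc_zero, removeNth_zero_vecCons, Matrix.cons_val_zero,
        Matrix.cons_val_succ, Fin.val_zero, zero_add, h0]
      congr 1
  rw [e]
  cases p with
  | zero =>
    simp only [koszulFun]
    simp [Subsingleton.elim (Fin.tail v) ![]]
    ring
  | succ p =>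
    have hS : ∑ i : Fin (p + 1), ∑ j ≥ i.succ, (-1 : ℤ) ^ ((i : ℕ) + 1 + j : ℕ) •
          θ (Matrix.vecCons (br (v i.castSucc) (v j))
            (j.removeNth (i.succ.castSucc.removeNth (Matrix.vecCons X v)))) =
        - ∑ i : Fin (p + 1), ∑ j ≥ i, (-1 : ℤ) ^ (i + j : ℕ) •
          (θ.curryLeft X) (Matrix.vecCons (br (v i.castSucc) (v j.succ))
            (j.removeNth (i.castSucc.removeNth v))) := by
      rw [← Finset.sum_neg_distrib]
      refine Finset.sum_congr rfl fun i _ => ?_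
      rw [Fin.sum_Ici_succ, ← Finset.sum_neg_distrib]
      refine Finset.sum_congr rfl fun j _ => ?_
      -- The only sign comes from moving `X` past the bracket: both indices shift by one, so the
      -- parity of the exponent does not change.
      rw [← Fin.succ_castSucc, removeNth_succ_vecCons, removeNth_succ_vecCons,
        alternating_cons_cons_swap, AlternatingMap.curryLeft_apply_apply, smul_neg]
      congr 2
      rw [Fin.val_succ, show (i : ℕ) + 1 + (j + 1) = i + j + 2 by ring, pow_add]
      simp
    rw [hS]
    simp only [koszulFun, AlternatingMap.curryLeft_apply_apply, pow_succ, mul_neg, mul_one,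
      neg_smul, Finset.sum_neg_distrib]
    abel

variable (hbr : ∀ X, br X X = 0)
  (hleib : ∀ (X Y : L) (f : A), br X (f • Y) = f • br X Y + ρ X f • Y)

/-- The Lie derivative `L_X = i_X D + D i_X` of forms. -/
def lieDer (X : L) : (p : ℕ) → (L [⋀^Fin p]→ₗ[A] A) →ₗ[ℝ] (L [⋀^Fin p]→ₗ[A] A)
  | 0 =>
    { toFun := fun θ => (koszul ρ br hbr hleib 0 θ).curryLeft X
      map_add' := fun θ η => by rw [map_add, AlternatingMap.curryLeft_add]; rfl
      map_smul' := fun c θ => by ext v; simp }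
  | p + 1 =>
    { toFun := fun θ => (koszul ρ br hbr hleib (p + 1) θ).curryLeft X +
        koszul ρ br hbr hleib p (θ.curryLeft X)
      map_add' := fun θ η => by
        ext v
        simp only [map_add, AlternatingMap.curryLeft_add, LinearMap.add_apply,
          AlternatingMap.add_apply]
        abel
      map_smul' := fun c θ => by
        have h : (c • θ).curryLeft X = c • θ.curryLeft X := by ext v; simp
        ext v
        rw [h, map_smul, map_smul]
        simp }

theorem curryLeft_koszul_zero (X : L) (θ : L [⋀^Fin 0]→ₗ[A] A) :
    (koszul ρ br hbr hleib 0 θ).curryLeft X = lieDer ρ br hbr hleib X 0 θ := rfl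

theorem curryLeft_koszul_succ (X : L) {p : ℕ} (θ : L [⋀^Fin (p + 1)]→ₗ[A] A) :
    (koszul ρ br hbr hleib (p + 1) θ).curryLeft X =
      lieDer ρ br hbr hleib X (p + 1) θ - koszul ρ br hbr hleib p (θ.curryLeft X) := by
  exact (add_sub_cancel_right _ _).symm

/-- The two occurrences of `D i_X θ` cancel, by `koszulFun_cons`. Degree `0` is separate because
there `i_X θ` does not exist. -/
theorem lieDer_apply (X : L) {p : ℕ} (θ : L [⋀^Fin p]→ₗ[A] A) (v : Fin p → L) :
    lieDer ρ br hbr hleib X p θ v =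
      ρ X (θ v) - ∑ j : Fin p, θ (Function.update v j (br X (v j))) := by
  cases p with
  | zero =>
    change koszulFun ρ (fun X Y => br X Y) 0 θ _ = _
    simp only [koszulFun]
    simp [Subsingleton.elim v ![]]
  | succ p =>
    change koszulFun ρ (fun X Y => br X Y) (p + 1) θ (Matrix.vecCons X v) +
      koszulFun ρ (fun X Y => br X Y) p (θ.curryLeft X) v = _
    rw [koszulFun_cons, sub_add_cancel]

/-- Cartan's relation `i_Z L_X = L_X i_Z - i_[X,Z]`: the summand of `lieDer_apply` that brackets the
first argument `Z` is the correction term. -/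
theorem curryLeft_lieDer (X Z : L) {p : ℕ} (θ : L [⋀^Fin (p + 1)]→ₗ[A] A) :
    (lieDer ρ br hbr hleib X (p + 1) θ).curryLeft Z =
      lieDer ρ br hbr hleib X p (θ.curryLeft Z) - θ.curryLeft (br X Z) := by
  ext v
  rw [AlternatingMap.sub_apply, AlternatingMap.curryLeft_apply_apply, lieDer_apply, lieDer_apply,
    Fin.sum_univ_succ]
  have h1 : Function.update (Matrix.vecCons Z v) 0 (br X (Matrix.vecCons Z v 0)) =
      Matrix.vecCons (br X Z) v := by
    funext l
    cases l using Fin.cases <;> simp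
  have h2 : ∀ (j : Fin p) (Y : L), Function.update (Matrix.vecCons Z v) j.succ Y =
      Matrix.vecCons Z (Function.update v j Y) := by
    intro j Y
    funext l
    cases l using Fin.cases <;> simp [Function.update_apply, (Fin.succ_ne_zero _).symm]
  simp only [h1, h2, AlternatingMap.curryLeft_apply_apply, Matrix.cons_val_succ]
  abel


/-- On functions this is the hypothesis `hρ`. In higher degree, contraction with `Z` reduces it to
one degree lower, and the correction terms cancel by the Jacobi identity. -/
theorem lieDer_bracket
    (hjac : ∀ X Y Z, br X (br Y Z) = br (br X Y) Z + br Y (br X Z))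
    (hρ : ∀ X Y f, ρ (br X Y) f = ρ X (ρ Y f) - ρ Y (ρ X f)) (X Y : L) {p : ℕ} (θ : L [⋀^Fin p]→ₗ[A] A) :
    lieDer ρ br hbr hleib (br X Y) p θ =
      lieDer ρ br hbr hleib X p (lieDer ρ br hbr hleib Y p θ) -
        lieDer ρ br hbr hleib Y p (lieDer ρ br hbr hleib X p θ) := by
  induction p with
  | zero =>
    ext v
    simp [lieDer_apply, hρ]
  | succ p ih =>
    refine alternating_ext_curryLeft fun Z => ?_
    have hs : ∀ (α β : L [⋀^Fin (p + 1)]→ₗ[A] A), (α - β).curryLeft Z =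
        α.curryLeft Z - β.curryLeft Z := fun α β => rfl
    rw [hs]
    simp only [curryLeft_lieDer, map_sub, ih, hjac X Y Z, map_add]
    abel

/-- After contraction with `Z`, replacing `i_Z D` by `L_Z - D i_Z` leaves the commutator of `L_X`
with `L_Z` and an instance of lower degree. -/
theorem lieDer_koszul
    (hjac : ∀ X Y Z, br X (br Y Z) = br (br X Y) Z + br Y (br X Z))
    (hρ : ∀ X Y f, ρ (br X Y) f = ρ X (ρ Y f) - ρ Y (ρ X f)) (X : L) {p : ℕ} (θ : L [⋀^Fin p]→ₗ[A] A) :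
    lieDer ρ br hbr hleib X (p + 1) (koszul ρ br hbr hleib p θ) =
      koszul ρ br hbr hleib p (lieDer ρ br hbr hleib X p θ) := by
  induction p with
  | zero =>
    refine alternating_ext_curryLeft fun Z => ?_
    rw [curryLeft_lieDer]
    simp only [curryLeft_koszul_zero, lieDer_bracket ρ br hbr hleib hjac hρ]
    abel
  | succ p ih =>
    refine alternating_ext_curryLeft fun Z => ?_
    rw [curryLeft_lieDer]
    simp only [curryLeft_koszul_succ, lieDer_bracket ρ br hbr hleib hjac hρ, map_sub, ih,
      curryLeft_lieDer]
    abel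

/-- `i_Z D D = L_Z D - D (L_Z - D i_Z) = D D i_Z`, which vanishes by induction. -/
theorem koszul_koszul
    (hjac : ∀ X Y Z, br X (br Y Z) = br (br X Y) Z + br Y (br X Z))
    (hρ : ∀ X Y f, ρ (br X Y) f = ρ X (ρ Y f) - ρ Y (ρ X f)) {p : ℕ} (θ : L [⋀^Fin p]→ₗ[A] A) :
    koszul ρ br hbr hleib (p + 1) (koszul ρ br hbr hleib p θ) = 0 := by
  induction p with
  | zero =>
    refine alternating_ext_curryLeft fun Z => ?_
    rw [curryLeft_koszul_succ, curryLeft_koszul_zero, lieDer_koszul ρ br hbr hleib hjac hρ,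
      sub_self]
    rfl
  | succ p ih =>
    refine alternating_ext_curryLeft fun Z => ?_
    rw [curryLeft_koszul_succ, curryLeft_koszul_succ, lieDer_koszul ρ br hbr hleib hjac hρ,
      map_sub, ih, sub_zero, sub_self]
    rfl

end Cartan

end FoliatedAlgebroid

end
-- Wedge products, and `D` as a derivation of degree one.
noncomputable section

namespace FoliatedAlgebroid

section Wedge

variable {A L : Type*} [CommRing A] [AddCommGroup L] [Module A L]

/-- The identification of the positions of the factors of a product of forms of degrees `p` and
`r` with the positions of the product. -/
def shuffleEquiv {p r N : ℕ} (h : p + r = N) : Fin p ⊕ Fin r ≃ Fin N :=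
  finSumFinEquiv.trans (finCongr h)

theorem shuffleEquiv_inl_val {p r N : ℕ} (h : p + r = N) (i : Fin p) :
    (shuffleEquiv h (Sum.inl i) : ℕ) = i := by simp [shuffleEquiv]

theorem shuffleEquiv_inr_val {p r N : ℕ} (h : p + r = N) (i : Fin r) :
    (shuffleEquiv h (Sum.inr i) : ℕ) = p + i := by simp [shuffleEquiv]

/-- The wedge product of forms of degrees `p` and `r`, as a form of degree `N = p + r`. -/
def wedgeN {p r N : ℕ} (h : p + r = N) (α : L [⋀^Fin p]→ₗ[A] A) (β : L [⋀^Fin r]→ₗ[A] A) :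
    L [⋀^Fin N]→ₗ[A] A :=
  ((LinearMap.mul' A A).compAlternatingMap (α.domCoprod β)).domDomCongr (shuffleEquiv h)

/-- The tensor product of two forms, as a function. -/
def tensorFun {p r N : ℕ} (h : p + r = N) (α : L [⋀^Fin p]→ₗ[A] A) (β : L [⋀^Fin r]→ₗ[A] A)
    (w : Fin N → L) : A :=
  α (fun i => w (shuffleEquiv h (Sum.inl i))) * β (fun i => w (shuffleEquiv h (Sum.inr i)))

/-- The wedge sums over shuffles, that is, over cosets of permutations. Multiplied by `p! r!` it
becomes a sum over all permutations, which is easier to reindex; the factor is invertible over `ℝ`.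
-/
theorem factorial_smul_wedgeN {p r N : ℕ} (h : p + r = N) (α : L [⋀^Fin p]→ₗ[A] A)
    (β : L [⋀^Fin r]→ₗ[A] A) (v : Fin N → L) :
    (p.factorial * r.factorial) • wedgeN h α β v =
      ∑ τ : Equiv.Perm (Fin N), Equiv.Perm.sign τ • tensorFun h α β (fun i => v (τ i)) := by
  have h1 := congrArg (fun T => LinearMap.mul' A A (T fun i => v (shuffleEquiv h i)))
    (MultilinearMap.domCoprod_alternization_eq α β)
  simp only [Fintype.card_fin, AlternatingMap.smul_apply, map_nsmul,
    MultilinearMap.alternatization_apply] at h1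
  refine Eq.trans h1.symm ?_
  rw [map_sum, ← Equiv.sum_comp (shuffleEquiv h).permCongr]
  refine Finset.sum_congr rfl fun σ _ => ?_
  rw [Equiv.Perm.sign_permCongr]
  simp only [tensorFun, Equiv.permCongr_apply, Equiv.symm_apply_apply]
  rcases Int.units_eq_one_or (Equiv.Perm.sign σ) with h | h <;> simp [h]

/-- Permutations of `Fin (N + 1)`, described by the preimage of `0` and a permutation of the
remaining positions. -/
theorem sum_perm_cons {N : ℕ} (F : (Fin (N + 1) → L) → A) (X : L) (u : Fin N → L) :
    ∑ τ : Equiv.Perm (Fin (N + 1)), Equiv.Perm.sign τ • F (fun i => Matrix.vecCons X u (τ i)) =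
      ∑ k : Fin (N + 1), ∑ e : Equiv.Perm (Fin N),
        Equiv.Perm.sign e • (-1 : ℤˣ) ^ (k : ℕ) • F (k.insertNth X fun i => u (e i)) := by
  -- First `cycleRange` brings position `k` to `0`, with sign `(-1)^k`; then `e` permutes the others
  -- and fixes `0`. Injectivity suffices, since `(N + 1) · N! = (N + 1)!`.
  let ψ : Fin (N + 1) × Equiv.Perm (Fin N) → Equiv.Perm (Fin (N + 1)) := fun x =>
    Equiv.Perm.decomposeFin.symm (0, x.2) * x.1.cycleRange
  have hψ : Function.Bijective ψ := by
    rw [Fintype.bijective_iff_injective_and_card]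
    constructor
    · rintro ⟨k, e⟩ ⟨k', e'⟩ hk
      have h0 : ∀ (k : Fin (N + 1)) (e : Equiv.Perm (Fin N)), ψ (k, e) k = 0 := by
        intro k e
        simp [ψ]
      have h1 : k = k' := by
        apply (ψ (k, e)).injective
        rw [h0, hk, h0]
      subst h1
      have h2 := mul_right_cancel hk
      simpa using h2
    · simp [Fintype.card_perm, Nat.factorial_succ]
  rw [← Fintype.sum_prod_type', ← hψ.sum_comp]
  refine Finset.sum_congr rfl fun x _ => ?_
  obtain ⟨k, e⟩ := x
  have h1 : (fun i => Matrix.vecCons X u (ψ (k, e) i)) = k.insertNth X fun i => u (e i) := by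
    rw [← Fin.cons_comp_cycleRange]
    funext i
    simp only [ψ, Function.comp_apply, Equiv.Perm.mul_apply]
    generalize k.cycleRange i = l
    cases l using Fin.cases with
    | zero => simp
    | succ l => simp [Equiv.Perm.decomposeFin_symm_apply_succ]
  rw [h1, smul_smul]
  congr 1
  simp [ψ, Fin.sign_cycleRange]

/-- Moving `X` from slot `i` of `α` to the front costs `(-1)^i`, which cancels the given sign. The
value no longer depends on `i`. -/
theorem tensorFun_insertNth_inl {p r N : ℕ} (h : p + 1 + r = N + 1) (h' : p + r = N)
    (α : L [⋀^Fin (p + 1)]→ₗ[A] A) (β : L [⋀^Fin r]→ₗ[A] A) (X : L) (w : Fin N → L)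
    (i : Fin (p + 1)) :
    (-1 : ℤˣ) ^ (i : ℕ) •
      tensorFun h α β ((shuffleEquiv h (Sum.inl i)).insertNth (α := fun _ => L) X w) =
        tensorFun h' (α.curryLeft X) β w := by
  have hl : (fun l => (shuffleEquiv h (Sum.inl i)).insertNth (α := fun _ => L) X w
      (shuffleEquiv h (Sum.inl l))) = i.insertNth (α := fun _ => L) X
        fun l => w (shuffleEquiv h' (Sum.inl l)) := by
    funext l
    cases l using i.succAboveCases with
    | x => simp
    | p l =>
      have : shuffleEquiv h (Sum.inl (i.succAbove l)) =
          (shuffleEquiv h (Sum.inl i)).succAbove (shuffleEquiv h' (Sum.inl l)) := by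
        ext
        simp only [shuffleEquiv_inl_val, Fin.succAbove, Fin.lt_def, Fin.val_castSucc]
        split_ifs <;> simp [shuffleEquiv_inl_val]
      rw [this]
      simp
  have hr : (fun l => (shuffleEquiv h (Sum.inl i)).insertNth (α := fun _ => L) X w
      (shuffleEquiv h (Sum.inr l))) = fun l => w (shuffleEquiv h' (Sum.inr l)) := by
    funext l
    have : shuffleEquiv h (Sum.inr l) =
        (shuffleEquiv h (Sum.inl i)).succAbove (shuffleEquiv h' (Sum.inr l)) := by
      ext
      rw [Fin.succAbove_of_le_castSucc]
      · simp only [Fin.val_succ, shuffleEquiv_inr_val]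
        omega
      · simp only [Fin.le_def, Fin.val_castSucc, shuffleEquiv_inl_val, shuffleEquiv_inr_val]
        omega
    rw [this]
    simp
  rw [tensorFun, hl, hr, α.map_insertNth, tensorFun, AlternatingMap.curryLeft_apply_apply,
    smul_mul_assoc]
  simp only [Units.smul_def, smul_smul]
  simp [← mul_pow]

/-- Here `X` sits at position `p + i`, but only the `i` slots of `β` are crossed, so `(-1)^p`
survives: the sign of the antiderivation rule for `i_X`. -/
theorem tensorFun_insertNth_inr {p r N : ℕ} (h : p + (r + 1) = N + 1) (h' : p + r = N)
    (α : L [⋀^Fin p]→ₗ[A] A) (β : L [⋀^Fin (r + 1)]→ₗ[A] A) (X : L) (w : Fin N → L)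
    (i : Fin (r + 1)) :
    (-1 : ℤˣ) ^ (p + i : ℕ) •
      tensorFun h α β ((shuffleEquiv h (Sum.inr i)).insertNth (α := fun _ => L) X w) =
        (-1 : ℤˣ) ^ p • tensorFun h' α (β.curryLeft X) w := by
  have hr : (fun l => (shuffleEquiv h (Sum.inr i)).insertNth (α := fun _ => L) X w
      (shuffleEquiv h (Sum.inr l))) = i.insertNth (α := fun _ => L) X
        fun l => w (shuffleEquiv h' (Sum.inr l)) := by
    funext l
    cases l using i.succAboveCases with
    | x => simp
    | p l =>
      have : shuffleEquiv h (Sum.inr (i.succAbove l)) =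
          (shuffleEquiv h (Sum.inr i)).succAbove (shuffleEquiv h' (Sum.inr l)) := by
        ext
        simp only [shuffleEquiv_inr_val, Fin.succAbove, Fin.lt_def, Fin.val_castSucc,
          add_lt_add_iff_left]
        split_ifs <;> simp [shuffleEquiv_inr_val, add_assoc]
      rw [this]
      simp
  have hl : (fun l => (shuffleEquiv h (Sum.inr i)).insertNth (α := fun _ => L) X w
      (shuffleEquiv h (Sum.inl l))) = fun l => w (shuffleEquiv h' (Sum.inl l)) := by
    funext l
    have : shuffleEquiv h (Sum.inl l) =
        (shuffleEquiv h (Sum.inr i)).succAbove (shuffleEquiv h' (Sum.inl l)) := by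
      ext
      rw [Fin.succAbove_of_castSucc_lt]
      · simp only [Fin.val_castSucc, shuffleEquiv_inl_val]
      · simp only [Fin.lt_def, Fin.val_castSucc, shuffleEquiv_inl_val, shuffleEquiv_inr_val]
        omega
    rw [this]
    simp
  rw [tensorFun, hl, hr, β.map_insertNth, tensorFun, AlternatingMap.curryLeft_apply_apply,
    mul_smul_comm, pow_add, mul_smul]
  congr 1
  simp only [Units.smul_def, smul_smul]
  simp [← mul_pow]

theorem sum_perm_tensorFun_cons {p r N : ℕ} (h : p + r = N + 1) (α : L [⋀^Fin p]→ₗ[A] A)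
    (β : L [⋀^Fin r]→ₗ[A] A) (X : L) (u : Fin N → L) :
    (p.factorial * r.factorial) • wedgeN h α β (Matrix.vecCons X u) =
      (∑ i : Fin p, ∑ e : Equiv.Perm (Fin N), Equiv.Perm.sign e • (-1 : ℤˣ) ^ (i : ℕ) •
        tensorFun h α β ((shuffleEquiv h (Sum.inl i)).insertNth (α := fun _ => L) X
          fun i => u (e i))) +
      ∑ i : Fin r, ∑ e : Equiv.Perm (Fin N), Equiv.Perm.sign e • (-1 : ℤˣ) ^ (p + i : ℕ) •
        tensorFun h α β ((shuffleEquiv h (Sum.inr i)).insertNth (α := fun _ => L) X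
          fun i => u (e i)) := by
  rw [factorial_smul_wedgeN, sum_perm_cons, ← Equiv.sum_comp (shuffleEquiv h),
    Fintype.sum_sum_type]
  simp only [shuffleEquiv_inl_val, shuffleEquiv_inr_val]

variable [Algebra ℝ A]

theorem smul_factorial_cancel (p r : ℕ) {a b : A}
    (h : (p.factorial * r.factorial) • a = (p.factorial * r.factorial) • b) : a = b := by
  rw [← Nat.cast_smul_eq_nsmul ℝ, ← Nat.cast_smul_eq_nsmul ℝ (_ * _) b] at h
  have h0 : ((p.factorial * r.factorial : ℕ) : ℝ) ≠ 0 := by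
    exact_mod_cast (Nat.mul_pos p.factorial_pos r.factorial_pos).ne'
  have := congrArg (fun x => ((p.factorial * r.factorial : ℕ) : ℝ)⁻¹ • x) h
  simpa only [smul_smul, inv_mul_cancel₀ h0, one_smul] using this

/-- The `p + 1` slots contribute equally, which turns `p! r!` into `(p + 1)! r!`. -/
theorem sum_inl_eq {p r N : ℕ} (h : p + 1 + r = N + 1) (h' : p + r = N)
    (α : L [⋀^Fin (p + 1)]→ₗ[A] A) (β : L [⋀^Fin r]→ₗ[A] A) (X : L) (u : Fin N → L) :
    (∑ i : Fin (p + 1), ∑ e : Equiv.Perm (Fin N), Equiv.Perm.sign e • (-1 : ℤˣ) ^ (i : ℕ) •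
        tensorFun h α β ((shuffleEquiv h (Sum.inl i)).insertNth (α := fun _ => L) X
          fun i => u (e i))) =
      ((p + 1).factorial * r.factorial) • wedgeN h' (α.curryLeft X) β u := by
  simp only [tensorFun_insertNth_inl h h', ← factorial_smul_wedgeN, Finset.sum_const,
    Finset.card_univ, Fintype.card_fin, smul_smul, Nat.factorial_succ, mul_assoc]

theorem sum_inr_eq {p r N : ℕ} (h : p + (r + 1) = N + 1) (h' : p + r = N)
    (α : L [⋀^Fin p]→ₗ[A] A) (β : L [⋀^Fin (r + 1)]→ₗ[A] A) (X : L) (u : Fin N → L) :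
    (∑ i : Fin (r + 1), ∑ e : Equiv.Perm (Fin N),
        Equiv.Perm.sign e • (-1 : ℤˣ) ^ (p + i : ℕ) •
        tensorFun h α β ((shuffleEquiv h (Sum.inr i)).insertNth (α := fun _ => L) X
          fun i => u (e i))) =
      (p.factorial * (r + 1).factorial) • (-1 : ℝ) ^ p • wedgeN h' α (β.curryLeft X) u := by
  have hs : ∀ a : A, (-1 : ℤˣ) ^ p • a = (-1 : ℝ) ^ p • a := by
    intro a
    rcases neg_one_pow_eq_or ℤ p with hp | hp <;> rcases Nat.even_or_odd p with hp | hp <;>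
      simp [hp.neg_one_pow, Units.smul_def]
  have h1 : ∑ e : Equiv.Perm (Fin N), Equiv.Perm.sign e • (-1 : ℤˣ) ^ p •
      tensorFun h' α (β.curryLeft X) (fun i => u (e i)) =
        (p.factorial * r.factorial) • (-1 : ℝ) ^ p • wedgeN h' α (β.curryLeft X) u := by
    simp only [smul_comm _ ((-1 : ℤˣ) ^ p)]
    rw [← Finset.smul_sum, ← factorial_smul_wedgeN, hs, smul_comm]
  simp only [tensorFun_insertNth_inr h h', h1, Finset.sum_const, Finset.card_univ,
    Fintype.card_fin]
  rw [smul_smul, Nat.factorial_succ]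
  congr 1
  ring

theorem curryLeft_wedgeN_succ_zero {p N : ℕ} (h : p + 1 + 0 = N + 1) (h' : p + 0 = N)
    (α : L [⋀^Fin (p + 1)]→ₗ[A] A) (β : L [⋀^Fin 0]→ₗ[A] A) (X : L) :
    (wedgeN h α β).curryLeft X = wedgeN h' (α.curryLeft X) β := by
  ext u
  apply smul_factorial_cancel (p + 1) 0
  rw [AlternatingMap.curryLeft_apply_apply, sum_perm_tensorFun_cons, sum_inl_eq h h']
  simp

theorem curryLeft_wedgeN_zero_succ {r N : ℕ} (h : 0 + (r + 1) = N + 1) (h' : 0 + r = N)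
    (α : L [⋀^Fin 0]→ₗ[A] A) (β : L [⋀^Fin (r + 1)]→ₗ[A] A) (X : L) :
    (wedgeN h α β).curryLeft X = wedgeN h' α (β.curryLeft X) := by
  ext u
  apply smul_factorial_cancel 0 (r + 1)
  rw [AlternatingMap.curryLeft_apply_apply, sum_perm_tensorFun_cons, sum_inr_eq h h']
  simp

theorem curryLeft_wedgeN_succ_succ {p r N : ℕ} (h : p + 1 + (r + 1) = N + 1)
    (h₁ : p + (r + 1) = N) (h₂ : p + 1 + r = N)
    (α : L [⋀^Fin (p + 1)]→ₗ[A] A) (β : L [⋀^Fin (r + 1)]→ₗ[A] A) (X : L) :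
    (wedgeN h α β).curryLeft X =
      wedgeN h₁ (α.curryLeft X) β + (-1 : ℝ) ^ (p + 1) • wedgeN h₂ α (β.curryLeft X) := by
  ext u
  apply smul_factorial_cancel (p + 1) (r + 1)
  rw [AlternatingMap.curryLeft_apply_apply, sum_perm_tensorFun_cons, sum_inl_eq h h₁,
    sum_inr_eq h h₂, ← smul_add]
  rfl

theorem wedgeN_sub_left {p r N : ℕ} (h : p + r = N) (α α' : L [⋀^Fin p]→ₗ[A] A)
    (β : L [⋀^Fin r]→ₗ[A] A) : wedgeN h (α - α') β = wedgeN h α β - wedgeN h α' β := by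
  ext u
  apply smul_factorial_cancel p r
  simp only [AlternatingMap.sub_apply, smul_sub, factorial_smul_wedgeN, tensorFun, sub_mul,
    Finset.sum_sub_distrib]

theorem wedgeN_sub_right {p r N : ℕ} (h : p + r = N) (α : L [⋀^Fin p]→ₗ[A] A)
    (β β' : L [⋀^Fin r]→ₗ[A] A) : wedgeN h α (β - β') = wedgeN h α β - wedgeN h α β' := by
  ext u
  apply smul_factorial_cancel p r
  simp only [AlternatingMap.sub_apply, smul_sub, factorial_smul_wedgeN, tensorFun, mul_sub,
    Finset.sum_sub_distrib]

variable [Module ℝ L] [IsScalarTower ℝ A L]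
  (ρ : L →ₗ[A] Derivation ℝ A A) (br : L →ₗ[ℝ] L →ₗ[ℝ] L) (hbr : ∀ X, br X X = 0)
  (hleib : ∀ (X Y : L) (f : A), br X (f • Y) = f • br X Y + ρ X f • Y)

/-- The Leibniz rule for `L_X` before antisymmetrization: each position belongs to exactly one
factor, so the sum of bracket terms splits in two. -/
theorem deriv_tensorFun {p r N : ℕ} (h : p + r = N) (X : L) (α : L [⋀^Fin p]→ₗ[A] A)
    (β : L [⋀^Fin r]→ₗ[A] A) (w : Fin N → L) :
    ρ X (tensorFun h α β w) -
        ∑ k : Fin N, tensorFun h α β (Function.update w k (br X (w k))) =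
      tensorFun h (lieDer ρ br hbr hleib X p α) β w +
        tensorFun h α (lieDer ρ br hbr hleib X r β) w := by
  have hll : ∀ (i : Fin p) (Y : L), (fun l => Function.update w (shuffleEquiv h (Sum.inl i)) Y
      (shuffleEquiv h (Sum.inl l))) =
        Function.update (fun l => w (shuffleEquiv h (Sum.inl l))) i Y := by
    intro i Y
    funext l
    simp [Function.update_apply]
  have hrr : ∀ (i : Fin r) (Y : L), (fun l => Function.update w (shuffleEquiv h (Sum.inr i)) Y
      (shuffleEquiv h (Sum.inr l))) =
        Function.update (fun l => w (shuffleEquiv h (Sum.inr l))) i Y := by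
    intro i Y
    funext l
    simp [Function.update_apply]
  have hlr : ∀ (i : Fin p) (Y : L), (fun l => Function.update w (shuffleEquiv h (Sum.inl i)) Y
      (shuffleEquiv h (Sum.inr l))) = fun l => w (shuffleEquiv h (Sum.inr l)) := by
    intro i Y
    funext l
    simp
  have hrl : ∀ (i : Fin r) (Y : L), (fun l => Function.update w (shuffleEquiv h (Sum.inr i)) Y
      (shuffleEquiv h (Sum.inl l))) = fun l => w (shuffleEquiv h (Sum.inl l)) := by
    intro i Y
    funext l
    simp
  rw [← Equiv.sum_comp (shuffleEquiv h), Fintype.sum_sum_type]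
  simp only [tensorFun, hll, hrr, hlr, hrl, lieDer_apply, Derivation.leibniz, smul_eq_mul,
    sub_mul, mul_sub, Finset.sum_mul, Finset.mul_sum]
  ring

theorem lieDer_wedgeN {p r N : ℕ} (h : p + r = N) (X : L) (α : L [⋀^Fin p]→ₗ[A] A)
    (β : L [⋀^Fin r]→ₗ[A] A) :
    lieDer ρ br hbr hleib X N (wedgeN h α β) =
      wedgeN h (lieDer ρ br hbr hleib X p α) β + wedgeN h α (lieDer ρ br hbr hleib X r β) := by
  ext v
  apply smul_factorial_cancel p r
  rw [lieDer_apply, AlternatingMap.add_apply, smul_add, smul_sub, ← map_nsmul, Finset.smul_sum]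
  simp only [factorial_smul_wedgeN]
  rw [map_sum, Finset.sum_comm, ← Finset.sum_sub_distrib, ← Finset.sum_add_distrib]
  refine Finset.sum_congr rfl fun τ _ => ?_
  -- Changing entry `k` of the permuted tuple is changing entry `τ k` of the original one, hence the
  -- reindexing by `τ`.
  rw [← smul_add, ← deriv_tensorFun ρ br hbr hleib, smul_sub, Finset.smul_sum,
    ← Equiv.sum_comp τ]
  congr 1
  · simp [Units.smul_def]
  · refine Finset.sum_congr rfl fun k _ => ?_
    congr 2
    funext l
    simp [Function.update_apply]

/-- Induction on the total degree from `i_X D = L_X - D i_X`, as `L_X` is a derivation and `i_X` an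
antiderivation of `∧`. Keeping the total degree as a variable `N` lets products such as `Dα ∧ β` and
`α ∧ Dβ` share a type without casts. -/
theorem koszul_wedgeN {p r N : ℕ} (h : p + r = N) (h₁ : p + 1 + r = N + 1)
    (h₂ : p + (r + 1) = N + 1) (α : L [⋀^Fin p]→ₗ[A] A) (β : L [⋀^Fin r]→ₗ[A] A) :
    koszul ρ br hbr hleib N (wedgeN h α β) =
      wedgeN h₁ (koszul ρ br hbr hleib p α) β +
        (-1 : ℝ) ^ p • wedgeN h₂ α (koszul ρ br hbr hleib r β) := by
  have ha : ∀ (X : L) {q : ℕ} (θ η : L [⋀^Fin (q + 1)]→ₗ[A] A), (θ + η).curryLeft X =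
      θ.curryLeft X + η.curryLeft X := fun _ _ _ _ => rfl
  have hs : ∀ (X : L) {q : ℕ} (c : ℝ) (θ : L [⋀^Fin (q + 1)]→ₗ[A] A), (c • θ).curryLeft X =
      c • θ.curryLeft X := fun _ _ _ _ => rfl
  induction N generalizing p r with
  | zero =>
    obtain rfl : p = 0 := by omega
    obtain rfl : r = 0 := by omega
    refine alternating_ext_curryLeft fun X => ?_
    rw [curryLeft_koszul_zero, ha, hs, curryLeft_wedgeN_succ_zero h₁ h,
      curryLeft_wedgeN_zero_succ h₂ h, lieDer_wedgeN]
    simp [curryLeft_koszul_zero]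
  | succ N ih =>
    refine alternating_ext_curryLeft fun X => ?_
    rw [curryLeft_koszul_succ, ha, hs, lieDer_wedgeN]
    -- A factor of degree `0` has no contraction, so the antiderivation rule takes a different form
    -- in each case.
    rcases p with _ | p <;> rcases r with _ | r
    · omega
    · rw [curryLeft_wedgeN_zero_succ h (by omega),
        curryLeft_wedgeN_succ_succ h₁ h (by omega),
        curryLeft_wedgeN_zero_succ h₂ h, ih _ (by omega) (by omega), curryLeft_koszul_zero,
        curryLeft_koszul_succ, wedgeN_sub_right]
      simp
      module
    · rw [curryLeft_wedgeN_succ_zero h (by omega), curryLeft_wedgeN_succ_zero h₁ h,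
        curryLeft_wedgeN_succ_succ h₂ (by omega) h, ih _ (by omega) (by omega),
        curryLeft_koszul_zero, curryLeft_koszul_succ, wedgeN_sub_left, smul_add, smul_smul,
        ← mul_pow, pow_succ]
      simp
      module
    · rw [curryLeft_wedgeN_succ_succ h (by omega) (by omega),
        curryLeft_wedgeN_succ_succ h₁ h (by omega),
        curryLeft_wedgeN_succ_succ h₂ (by omega) h, map_add, map_smul,
        ih _ (by omega) (by omega), ih _ (by omega) (by omega),
        curryLeft_koszul_succ, curryLeft_koszul_succ, wedgeN_sub_left, wedgeN_sub_right]
      simp only [smul_add, smul_sub, smul_smul, pow_succ]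
      simp [← mul_pow]
      module

end Wedge

end FoliatedAlgebroid

end
-- The bigrading, described through pure tuples.
noncomputable section

namespace FoliatedAlgebroid

/-- The number of places where a Boolean tuple is true. -/
def trueCount {p : ℕ} (s : Fin p → Bool) : ℤ := ∑ i, (s i).toInt

theorem toInt_nonneg (t : Bool) : 0 ≤ t.toInt := by cases t <;> simp

theorem toInt_le_one (t : Bool) : t.toInt ≤ 1 := by cases t <;> simp

theorem trueCount_nonneg {p : ℕ} (s : Fin p → Bool) : 0 ≤ trueCount s :=
  Finset.sum_nonneg fun _ _ => toInt_nonneg _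

theorem trueCount_le {p : ℕ} (s : Fin p → Bool) : trueCount s ≤ p := by
  refine (Finset.sum_le_card_nsmul _ _ 1 fun _ _ => toInt_le_one _).trans ?_
  simp

theorem trueCount_eq_card {p : ℕ} (s : Fin p → Bool) :
    trueCount s = (Finset.univ.filter fun i => s i = true).card := by
  rw [trueCount, Finset.card_filter]
  push_cast
  refine Finset.sum_congr rfl fun i _ => ?_
  cases s i <;> simp

theorem trueCount_decide_mem {p : ℕ} (S : Finset (Fin p)) :
    trueCount (fun i => decide (i ∈ S)) = S.card := by
  simp [trueCount_eq_card]

theorem trueCount_removeNth {p : ℕ} (s : Fin (p + 1) → Bool) (i : Fin (p + 1)) :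
    trueCount (i.removeNth s) = trueCount s - (s i).toInt := by
  rw [trueCount, trueCount, Fin.sum_univ_succAbove _ i]
  simp [Fin.removeNth_apply]

theorem trueCount_vecCons {p : ℕ} (t : Bool) (s : Fin p → Bool) :
    trueCount (Matrix.vecCons t s) = t.toInt + trueCount s := by
  simp [trueCount, Fin.sum_univ_succ]

variable {n : ℕ} {M : Type*} [TopologicalSpace M] [ChartedSpace (EuclideanSpace ℝ (Fin n)) M]
  [IsManifold (𝓡 n) ∞ M]

namespace EhresmannConnection

variable {F : RegularFoliation n M} (c : EhresmannConnection F)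

theorem mem_horizontal {X : VF n M} : X ∈ c.horizontal ↔ c.proj X = 0 := LinearMap.mem_ker

theorem sub_proj_mem_horizontal (X : VF n M) : X - c.proj X ∈ c.horizontal := by
  rw [mem_horizontal, map_sub, proj_proj, sub_self]

/-- `Γ(TF)` for `true`, and `Γ(H)` for `false`. -/
def part (t : Bool) : Submodule (Fun n M) (VF n M) :=
  if t then F.sections else c.horizontal

/-- The vector fields `v i` with `s i` lie in `Γ(TF)`, and the others in `Γ(H)`. -/
def IsPure {p : ℕ} (s : Fin p → Bool) (v : Fin p → VF n M) : Prop := ∀ i, v i ∈ c.part (s i)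

theorem proj_mem_part (X : VF n M) : c.proj X ∈ c.part true := c.proj_mem X

theorem proj_of_mem_part {X : VF n M} (hX : X ∈ c.part true) : c.proj X = X := c.proj_of_mem hX

theorem proj_of_mem_part_false {X : VF n M} (hX : X ∈ c.part false) : c.proj X = 0 := hX

theorem lieBr_mem_part {X Y : VF n M} (hX : X ∈ c.part true) (hY : Y ∈ c.part true) :
    lieBr X Y ∈ c.part true := F.lieBr_mem hX hY

theorem IsPure.removeNth {c : EhresmannConnection F} {p : ℕ} {s : Fin (p + 1) → Bool}
    {v : Fin (p + 1) → VF n M} (h : c.IsPure s v) (i : Fin (p + 1)) :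
    c.IsPure (i.removeNth s) (i.removeNth v) := fun _ => h _

theorem IsPure.vecCons {c : EhresmannConnection F} {p : ℕ} {s : Fin p → Bool}
    {v : Fin p → VF n M} (h : c.IsPure s v) {t : Bool} {X : VF n M} (hX : X ∈ c.part t) :
    c.IsPure (Matrix.vecCons t s) (Matrix.vecCons X v) := by
  intro i
  cases i using Fin.cases with
  | zero => exact hX
  | succ i => exact h i

theorem isPure_sel {p : ℕ} (S : Finset (Fin p)) (v : Fin p → VF n M) :
    c.IsPure (fun i => decide (i ∈ S)) fun i => c.sel S i (v i) := by
  intro i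
  by_cases hi : i ∈ S
  · simpa [sel, hi] using c.proj_mem_part (v i)
  · simpa [sel, hi, part] using c.sub_proj_mem_horizontal (v i)

/-- Multilinear expansion of `v i = γ (v i) + (v i - γ (v i))`: one pure tuple for each set `S` of
vertical positions. -/
theorem sum_sel {p : ℕ} (θ : Form n M (VF n M) p) (v : Fin p → VF n M) :
    θ v = ∑ S : Finset (Fin p), θ fun i => c.sel S i (v i) := by
  have h := θ.toMultilinearMap.map_add_univ (fun i => c.proj (v i)) (fun i => v i - c.proj (v i))
  have h1 : ((fun i => c.proj (v i)) + fun i => v i - c.proj (v i)) = v := by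
    funext i
    simp
  rw [h1] at h
  refine h.trans (Finset.sum_congr rfl fun S _ => ?_)
  change θ _ = θ _
  congr 1
  funext i
  by_cases hi : i ∈ S <;> simp [sel, hi]

theorem form_ext_pure {p : ℕ} {θ η : Form n M (VF n M) p}
    (h : ∀ s v, c.IsPure s v → θ v = η v) : θ = η := by
  ext v : 1
  rw [c.sum_sel θ, c.sum_sel η]
  exact Finset.sum_congr rfl fun S _ => h _ _ (c.isPure_sel S v)

theorem sel_of_isPure {p : ℕ} {s : Fin p → Bool} {v : Fin p → VF n M} (h : c.IsPure s v)
    (S : Finset (Fin p)) (i : Fin p) :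
    c.sel S i (v i) = if i ∈ S ↔ s i = true then v i else 0 := by
  have hi := h i
  cases hs : s i
  · rw [hs] at hi
    by_cases hS : i ∈ S <;> simp [sel, hS, c.proj_of_mem_part_false hi]
  · rw [hs] at hi
    by_cases hS : i ∈ S <;> simp [sel, hS, c.proj_of_mem_part hi]

/-- Only the `S` equal to the set of vertical positions of `v` contributes; any other `S` inserts a
zero argument. -/
theorem typePart_of_isPure (b : ℤ) {p : ℕ} (θ : Form n M (VF n M) p) {s : Fin p → Bool}
    {v : Fin p → VF n M} (h : c.IsPure s v) :
    c.typePart b θ v = if trueCount s = b then θ v else 0 := by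
  have h1 : ∀ S : Finset (Fin p), (θ fun i => c.sel S i (v i)) =
      if S = Finset.univ.filter (fun i => s i = true) then θ v else 0 := by
    intro S
    simp only [c.sel_of_isPure h]
    split_ifs with hS
    · subst hS
      simp
    · have : ∃ i, ¬ (i ∈ S ↔ s i = true) := by
        by_contra! hc
        exact hS (by ext i; simpa using hc i)
      obtain ⟨i, hi⟩ := this
      exact θ.map_coord_zero i (by simp [hi])
  rw [typePart_apply]
  simp only [h1]
  rw [Finset.sum_ite_eq', trueCount_eq_card]
  simp

/-- A form which vanishes on pure arguments unless exactly `b` of them lie in `Γ(TF)`. -/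
def HasFibreDegree (b : ℤ) {p : ℕ} (θ : Form n M (VF n M) p) : Prop :=
  ∀ s v, c.IsPure s v → trueCount s ≠ b → θ v = 0

theorem hasFibreDegree_typePart (b : ℤ) {p : ℕ} (θ : Form n M (VF n M) p) :
    c.HasFibreDegree b (c.typePart b θ) := fun s v h hs => by
  rw [c.typePart_of_isPure b θ h, if_neg hs]

variable {c} in
theorem HasFibreDegree.typePart_eq {b : ℤ} {p : ℕ} {θ : Form n M (VF n M) p}
    (h : c.HasFibreDegree b θ) (b' : ℤ) : c.typePart b' θ = if b' = b then θ else 0 := by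
  refine c.form_ext_pure fun s v hv => ?_
  rw [c.typePart_of_isPure b' θ hv]
  have := h s v hv
  split_ifs with h1 h2 h2
  · rfl
  · exact this (by omega)
  · exact (this (by omega)).symm
  · rfl

variable {c} in
theorem HasFibreDegree.eq_zero {b : ℤ} {p : ℕ} {θ : Form n M (VF n M) p}
    (h : c.HasFibreDegree b θ) (hb : ¬ (0 ≤ b ∧ b ≤ p)) : θ = 0 :=
  c.form_ext_pure fun s v hv => h s v hv (by
    have := trueCount_nonneg s
    have := trueCount_le s
    omega)

theorem sum_typePart {p : ℕ} (θ : Form n M (VF n M) p) :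
    ∑ b ∈ Finset.range (p + 1), c.typePart b θ = θ := by
  refine c.form_ext_pure fun s v hv => ?_
  have h : ∀ T : Finset ℕ, (∑ b ∈ T, c.typePart b θ) v = ∑ b ∈ T, c.typePart b θ v := fun T =>
    map_sum (AddMonoidHom.mk' (fun η : Form n M (VF n M) p => η v) fun _ _ => rfl) _ T
  rw [h]
  simp only [c.typePart_of_isPure _ θ hv]
  have h0 := trueCount_nonneg s
  have h1 := trueCount_le s
  rw [Finset.sum_eq_single (trueCount s).toNat]
  · rw [if_pos (by omega)]
  · intro b _ hb
    rw [if_neg (by omega)]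
  · intro hb
    simp only [Finset.mem_range] at hb
    omega

theorem linearMap_ext_hasFibreDegree {p q : ℕ}
    {T T' : Form n M (VF n M) p →ₗ[ℝ] Form n M (VF n M) q}
    (h : ∀ (b : ℤ) (θ : Form n M (VF n M) p), c.HasFibreDegree b θ → T θ = T' θ) : T = T' := by
  ext1 θ
  rw [← c.sum_typePart θ, map_sum, map_sum]
  exact Finset.sum_congr rfl fun b _ => h b _ (c.hasFibreDegree_typePart b θ)

/-- As `a + b = p`, a pure tuple with fewer than `b` vertical entries has more than `a` horizontal
ones, so the two conditions exclude every count except `b`. Conversely, in the expansion `sum_sel`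
the sets incompatible with `S` give a zero argument, and the others have the wrong count. -/
theorem isOfType_iff {p : ℕ} (a b : ℤ) (θ : Form n M (VF n M) p) :
    c.IsOfType a b θ ↔ a + b = p ∧ c.HasFibreDegree b θ := by
  refine and_congr_right fun hab => ⟨fun h s v hv hs => ?_, fun h v S => ⟨fun hS hb => ?_,
    fun hS ha => ?_⟩⟩
  · rw [trueCount_eq_card] at hs
    rcases lt_or_gt_of_ne hs with h1 | h1
    · refine (h v (Finset.univ.filter fun i => s i = true)ᶜ).2 (fun i hi => ?_) ?_
      · have := hv i
        simp only [Finset.mem_compl, Finset.mem_filter, Finset.mem_univ, true_and,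
          Bool.not_eq_true] at hi
        rwa [hi] at this
      · rw [Finset.card_compl, Fintype.card_fin]
        have := Finset.card_le_univ (Finset.univ.filter fun i => s i = true)
        rw [Fintype.card_fin] at this
        omega
    · refine (h v (Finset.univ.filter fun i => s i = true)).1 (fun i hi => ?_) h1
      have := hv i
      simp only [Finset.mem_filter, Finset.mem_univ, true_and] at hi
      rwa [hi] at this
  · rw [c.sum_sel θ]
    refine Finset.sum_eq_zero fun T _ => ?_
    by_cases hT : S ⊆ T
    · refine h _ _ (c.isPure_sel T v) ?_
      rw [trueCount_decide_mem]
      have := Finset.card_le_card hT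
      omega
    · obtain ⟨i, hi, hi'⟩ := Finset.not_subset.1 hT
      exact θ.map_coord_zero i (by simp [sel, hi', c.proj_of_mem (hS i hi)])
  · rw [c.sum_sel θ]
    refine Finset.sum_eq_zero fun T _ => ?_
    by_cases hT : T ⊆ Sᶜ
    · refine h _ _ (c.isPure_sel T v) ?_
      rw [trueCount_decide_mem]
      have := Finset.card_le_card hT
      rw [Finset.card_compl, Fintype.card_fin] at this
      have := Finset.card_le_univ S
      rw [Fintype.card_fin] at this
      omega
    · obtain ⟨i, hi, hi'⟩ := Finset.not_subset.1 hT
      rw [Finset.mem_compl, not_not] at hi'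
      exact θ.map_coord_zero i (by simp [sel, hi, c.mem_horizontal.1 (hS i hi')])

variable {c} in
theorem HasFibreDegree.dComponent_eq {b : ℤ} {p : ℕ} {θ : Form n M (VF n M) p}
    (h : c.HasFibreDegree b θ) (j : ℤ) :
    c.dComponent j p θ = c.typePart (b + j) (extD n M p θ) := by
  -- The sum in `dComponent` runs over `0, …, p` only; for `b` outside this range the form itself is
  -- zero.
  by_cases hb : 0 ≤ b ∧ b ≤ p
  · have h1 : c.dComponent j p θ = ∑ b' ∈ Finset.range (p + 1),
        c.typePartL (b' + j) (p + 1) (extD n M p (c.typePart b' θ)) := by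
      simp only [dComponent, LinearMap.sum_apply]
      rfl
    rw [h1, Finset.sum_eq_single b.toNat]
    · rw [h.typePart_eq, if_pos (by omega), Int.toNat_of_nonneg hb.1]
      rfl
    · intro b' _ hb'
      rw [h.typePart_eq, if_neg (by omega), map_zero, map_zero]
    · intro hb'
      simp only [Finset.mem_range] at hb'
      omega
  · rw [h.eq_zero hb, map_zero, map_zero]
    exact (map_zero (c.typePartL (b + j) (p + 1))).symm

/-! ### Counting vertical arguments in the Koszul formulas of `d` and `D`. -/

variable {c} in
theorem HasFibreDegree.map_removeNth {b : ℤ} {p : ℕ} {θ : Form n M (VF n M) p}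
    (h : c.HasFibreDegree b θ) {s : Fin (p + 1) → Bool} {v : Fin (p + 1) → VF n M}
    (hv : c.IsPure s v) (i : Fin (p + 1)) (hs : trueCount s - (s i).toInt ≠ b) :
    θ (i.removeNth v) = 0 :=
  h _ _ (hv.removeNth i) (by rwa [trueCount_removeNth])

-- Since `i ≤ j`, the second removal takes out the original entry `j.succ`. The count thus loses the
-- entries at `i.castSucc` and `j.succ` and gains that of `X`.
variable {c} in
theorem HasFibreDegree.map_cons_removeNth {b : ℤ} {p : ℕ} {θ : Form n M (VF n M) (p + 1)}
    (h : c.HasFibreDegree b θ) {s : Fin (p + 2) → Bool} {v : Fin (p + 2) → VF n M}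
    (hv : c.IsPure s v) {i j : Fin (p + 1)} (hij : i ≤ j) {t : Bool} {X : VF n M}
    (hX : X ∈ c.part t)
    (hs : t.toInt + (trueCount s - (s i.castSucc).toInt - (s j.succ).toInt) ≠ b) :
    θ (Matrix.vecCons X (j.removeNth (i.castSucc.removeNth v))) = 0 :=
  h _ _ (((hv.removeNth _).removeNth j).vecCons hX) (by
    rwa [trueCount_vecCons, trueCount_removeNth, trueCount_removeNth, Fin.removeNth_apply,
      Fin.succAbove_of_le_castSucc _ _ (Fin.castSucc_le_castSucc_iff.2 hij)])

variable {c} in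
theorem map_cons_eq_add {p : ℕ} (θ : Form n M (VF n M) (p + 1)) (X : VF n M)
    (v : Fin p → VF n M) : θ (Matrix.vecCons X v) =
      θ (Matrix.vecCons (c.proj X) v) + θ (Matrix.vecCons (X - c.proj X) v) := by
  have := congrArg (fun T => T v) (θ.curryLeft.map_add (c.proj X) (X - c.proj X))
  rwa [add_sub_cancel] at this

/-- A derivative term drops one entry, and a bracket term trades two for one. Two vertical entries
could lower the count by two only through a horizontal part of their bracket, which involutivity
excludes; so there is no component `d_{-1,2}`. -/
theorem extD_apply_eq_zero {b : ℤ} {p : ℕ} {θ : Form n M (VF n M) p}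
    (h : c.HasFibreDegree b θ) {s : Fin (p + 1) → Bool} {v : Fin (p + 1) → VF n M}
    (hv : c.IsPure s v) (h₁ : trueCount s ≠ b - 1) (h₂ : trueCount s ≠ b)
    (h₃ : trueCount s ≠ b + 1) : extD n M p θ v = 0 := by
  have hR : ∀ i : Fin (p + 1), θ (i.removeNth v) = 0 := fun i => h.map_removeNth hv i (by
    cases s i <;> simp <;> omega)
  rw [LieAlgebroid.differential_apply]
  cases p with
  | zero =>
    rw [koszulFun, Subsingleton.elim (![] : Fin 0 → VF n M) ((0 : Fin 1).removeNth v), hR]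
    simp
  | succ p =>
    rw [koszulFun]
    simp only [tangentAlgebroid, hR, map_zero, smul_zero, Finset.sum_const_zero, zero_sub,
      neg_eq_zero]
    refine Finset.sum_eq_zero fun i _ => Finset.sum_eq_zero fun j hj => ?_
    rw [Finset.mem_Ici] at hj
    have hi' := hv i.castSucc
    have hj' := hv j.succ
    by_cases hs : s i.castSucc = true ∧ s j.succ = true
    · rw [hs.1] at hi'
      rw [hs.2] at hj'
      rw [h.map_cons_removeNth hv hj (c.lieBr_mem_part hi' hj'), smul_zero]
      simp [hs.1, hs.2]
      omega
    · have h1 : (s i.castSucc).toInt + (s j.succ).toInt = 0 ∨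
          (s i.castSucc).toInt + (s j.succ).toInt = 1 := by
        cases h1 : s i.castSucc <;> cases h2 : s j.succ <;> simp_all
      rw [map_cons_eq_add (c := c), h.map_cons_removeNth hv hj (c.proj_mem_part _),
        h.map_cons_removeNth hv hj (t := false) (c.sub_proj_mem_horizontal _), add_zero, smul_zero]
      · simp
        omega
      · simp
        omega

/-- By `bracket_eq`, `⟦X, Y⟧` is `[γX, γY]` plus the horizontal part of `[γX, Y] + [X, γY]`. This
and the next three lemmas evaluate it on pure pairs. -/
theorem bracket_of_mem_false_false {X Y : VF n M} (hX : X ∈ c.part false)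
    (hY : Y ∈ c.part false) : c.bracket X Y = 0 := by
  rw [bracket_eq, c.proj_of_mem_part_false hX, c.proj_of_mem_part_false hY]
  simp

theorem bracket_of_mem_true_true {X Y : VF n M} (hX : X ∈ c.part true)
    (hY : Y ∈ c.part true) : c.bracket X Y = lieBr X Y := by
  have := c.proj_of_mem_part (c.lieBr_mem_part hX hY)
  rw [bracket_eq, c.proj_of_mem_part hX, c.proj_of_mem_part hY, map_add, this]
  simp

theorem bracket_of_mem_true_false {X Y : VF n M} (hX : X ∈ c.part true)
    (hY : Y ∈ c.part false) : c.bracket X Y = lieBr X Y - c.proj (lieBr X Y) := by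
  rw [bracket_eq, c.proj_of_mem_part hX, c.proj_of_mem_part_false hY]
  simp

theorem bracket_of_mem_false_true {X Y : VF n M} (hX : X ∈ c.part false)
    (hY : Y ∈ c.part true) : c.bracket X Y = lieBr X Y - c.proj (lieBr X Y) := by
  rw [bracket_eq, c.proj_of_mem_part hY, c.proj_of_mem_part_false hX]
  simp

/-- Each term of `D` uses up exactly one vertical entry: the anchor kills horizontal fields, the
bracket of two horizontal fields is `0`, a mixed pair becomes horizontal, and two vertical entries
become one. -/
theorem hasFibreDegree_differential {b : ℤ} {p : ℕ} {θ : Form n M (VF n M) p}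
    (h : c.HasFibreDegree b θ) : c.HasFibreDegree (b + 1) (c.algebroid.differential p θ) := by
  intro s v hv hs
  have hR : ∀ i : Fin (p + 1), dirDeriv (c.proj (v i)) (θ (i.removeNth v)) = 0 := by
    intro i
    have hi := hv i
    cases hsi : s i
    · rw [hsi] at hi
      rw [c.proj_of_mem_part_false hi]
      simp
    · rw [h.map_removeNth hv i (by simp [hsi]; omega), map_zero]
  rw [LieAlgebroid.differential_apply]
  cases p with
  | zero =>
    rw [koszulFun, Subsingleton.elim (![] : Fin 0 → VF n M) ((0 : Fin 1).removeNth v)]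
    exact hR 0
  | succ p =>
    rw [koszulFun]
    simp only [algebroid, hR, smul_zero, Finset.sum_const_zero, zero_sub, neg_eq_zero]
    refine Finset.sum_eq_zero fun i _ => Finset.sum_eq_zero fun j hj => ?_
    rw [Finset.mem_Ici] at hj
    have hi' := hv i.castSucc
    have hj' := hv j.succ
    have hQ := c.sub_proj_mem_horizontal (lieBr (v i.castSucc) (v j.succ))
    cases hsi : s i.castSucc <;> cases hsj : s j.succ <;> rw [hsi] at hi' <;> rw [hsj] at hj'
    · rw [c.bracket_of_mem_false_false hi' hj', θ.map_coord_zero 0 (by simp), smul_zero]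
    · rw [c.bracket_of_mem_false_true hi' hj',
        h.map_cons_removeNth hv hj (t := false) hQ (by simp [hsi, hsj]; omega), smul_zero]
    · rw [c.bracket_of_mem_true_false hi' hj',
        h.map_cons_removeNth hv hj (t := false) hQ (by simp [hsi, hsj]; omega), smul_zero]
    · rw [c.bracket_of_mem_true_true hi' hj', h.map_cons_removeNth hv hj
        (c.lieBr_mem_part hi' hj') (by simp [hsi, hsj]; omega), smul_zero]

/-- What `d` has beyond `D` is horizontal derivatives, brackets of horizontal pairs, and vertical
parts of mixed brackets. None of these lowers the count `b + 1`, so `θ` vanishes on them. -/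
theorem differential_apply_eq_extD {b : ℤ} {p : ℕ} {θ : Form n M (VF n M) p}
    (h : c.HasFibreDegree b θ) {s : Fin (p + 1) → Bool} {v : Fin (p + 1) → VF n M}
    (hv : c.IsPure s v) (hs : trueCount s = b + 1) :
    c.algebroid.differential p θ v = extD n M p θ v := by
  have hR : ∀ i : Fin (p + 1), dirDeriv (c.proj (v i)) (θ (i.removeNth v)) =
      dirDeriv (v i) (θ (i.removeNth v)) := by
    intro i
    have hi := hv i
    cases hsi : s i
    · rw [h.map_removeNth hv i (by simp [hsi]; omega), map_zero, map_zero]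
    · rw [hsi] at hi
      rw [c.proj_of_mem_part hi]
  rw [LieAlgebroid.differential_apply, LieAlgebroid.differential_apply]
  cases p with
  | zero =>
    rw [koszulFun, koszulFun,
      Subsingleton.elim (![] : Fin 0 → VF n M) ((0 : Fin 1).removeNth v)]
    exact hR 0
  | succ p =>
    rw [koszulFun, koszulFun]
    simp only [algebroid, tangentAlgebroid, hR, LinearMap.id_apply]
    congr 1
    refine Finset.sum_congr rfl fun i _ => Finset.sum_congr rfl fun j hj => ?_
    rw [Finset.mem_Ici] at hj
    congr 1
    have hi' := hv i.castSucc
    have hj' := hv j.succ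
    have hQ := c.sub_proj_mem_horizontal (lieBr (v i.castSucc) (v j.succ))
    have hP := c.proj_mem_part (lieBr (v i.castSucc) (v j.succ))
    cases hsi : s i.castSucc <;> cases hsj : s j.succ <;> rw [hsi] at hi' <;> rw [hsj] at hj'
    · rw [c.bracket_of_mem_false_false hi' hj', θ.map_coord_zero 0 (by simp),
        map_cons_eq_add (c := c), h.map_cons_removeNth hv hj hP (by simp [hsi, hsj]; omega),
        h.map_cons_removeNth hv hj (t := false) hQ (by simp [hsi, hsj]; omega), add_zero]
    · rw [c.bracket_of_mem_false_true hi' hj',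
        map_cons_eq_add (c := c) θ (lieBr _ _),
        h.map_cons_removeNth hv hj hP (by simp [hsi, hsj]; omega), zero_add]
    · rw [c.bracket_of_mem_true_false hi' hj',
        map_cons_eq_add (c := c) θ (lieBr _ _),
        h.map_cons_removeNth hv hj hP (by simp [hsi, hsj]; omega), zero_add]
    · rw [c.bracket_of_mem_true_true hi' hj']

theorem differential_eq_d01 (p : ℕ) : c.algebroid.differential p = c.d01 p := by
  refine c.linearMap_ext_hasFibreDegree fun b θ h => ?_
  rw [h.dComponent_eq]
  refine c.form_ext_pure fun s v hv => ?_
  rw [c.typePart_of_isPure _ _ hv]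
  split_ifs with hs
  · exact c.differential_apply_eq_extD h hv hs
  · exact c.hasFibreDegree_differential h s v hv hs

theorem extD_eq_add (p : ℕ) : extD n M p = c.d10 p + c.d2m1 p + c.d01 p := by
  refine c.linearMap_ext_hasFibreDegree fun b θ h => ?_
  rw [LinearMap.add_apply, LinearMap.add_apply, h.dComponent_eq, h.dComponent_eq,
    h.dComponent_eq]
  refine c.form_ext_pure fun s v hv => ?_
  rw [AlternatingMap.add_apply, AlternatingMap.add_apply, c.typePart_of_isPure _ _ hv,
    c.typePart_of_isPure _ _ hv, c.typePart_of_isPure _ _ hv]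
  have := c.extD_apply_eq_zero h hv
  split_ifs <;> first | omega | simp
  exact this (by omega) (by omega) (by omega)

theorem isOfType_dComponent {p : ℕ} {a b : ℤ} {θ : Form n M (VF n M) p}
    (h : c.IsOfType a b θ) (j : ℤ) : c.IsOfType (a + 1 - j) (b + j) (c.dComponent j p θ) := by
  rw [isOfType_iff] at h ⊢
  refine ⟨by push_cast; omega, ?_⟩
  rw [h.2.dComponent_eq]
  exact c.hasFibreDegree_typePart _ _

/-! ### Annihilator forms and the isomorphism with foliated forms. -/

theorem mem_annForms_iff {p : ℕ} {θ : Form n M (VF n M) p} :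
    θ ∈ c.annForms p ↔ c.HasFibreDegree p θ := by
  refine ⟨fun h s v hv hs => ?_, fun h v hv => ?_⟩
  · have : ∃ i, s i = false := by
      by_contra! hc
      apply hs
      simp [trueCount, fun i => Bool.eq_true_of_not_eq_false (hc i)]
    obtain ⟨i, hi⟩ := this
    refine h v ⟨i, ?_⟩
    have := hv i
    rwa [hi] at this
  · obtain ⟨i, hi⟩ := hv
    have h1 := ((c.isOfType_iff 0 p θ).2 ⟨by simp, h⟩).2 v {i}
    exact h1.2 (by simpa using hi) (by simp)

/-- Annihilator forms have the top fibre degree `p`, and `D = d_{0,1}` takes it to the top degree `p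
+ 1`. -/
theorem d01_mem_annForms {p : ℕ} {θ : Form n M (VF n M) p} (h : θ ∈ c.annForms p) :
    c.d01 p θ ∈ c.annForms (p + 1) := by
  rw [← differential_eq_d01]
  rw [mem_annForms_iff] at h ⊢
  exact_mod_cast c.hasFibreDegree_differential h

theorem apply_proj_of_mem_annForms {p : ℕ} {θ : Form n M (VF n M) p} (h : θ ∈ c.annForms p)
    (v : Fin p → VF n M) : (θ fun i => c.proj (v i)) = θ v := by
  rw [c.sum_sel θ v, Finset.sum_eq_single Finset.univ]
  · simp [sel]
  · intro S _ hS
    obtain ⟨i, hi⟩ : ∃ i, i ∉ S := by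
      by_contra! hc
      exact hS (Finset.eq_univ_of_forall hc)
    refine h _ ⟨i, ?_⟩
    simpa [sel, hi] using c.sub_proj_mem_horizontal (v i)
  · simp

/-- The isomorphism `Γ(Λ^p T^*F) → Γ(Λ^p H⁰)`, `(h α)(X₁, …) = α(γ X₁, …)`. -/
def pullbackEquiv (p : ℕ) : Form n M F.sections p ≃ₗ[Fun n M] c.annForms p where
  toFun α := ⟨α.compLinearMap c.projF, by
    rintro v ⟨i, hi⟩
    exact α.map_coord_zero i (Subtype.ext (c.mem_horizontal.1 hi))⟩
  map_add' α β := rfl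
  map_smul' f α := rfl
  invFun θ := (θ : Form n M (VF n M) p).compLinearMap F.sections.subtype
  left_inv α := by
    ext v : 1
    change α _ = α _
    congr 1
    funext i
    exact Subtype.ext (c.proj_of_mem (v i).2)
  right_inv θ := by
    ext v : 2
    exact c.apply_proj_of_mem_annForms θ.2 v

theorem pullbackEquiv_apply (p : ℕ) (α : Form n M F.sections p) (v : Fin p → VF n M) :
    (c.pullbackEquiv p α : Form n M (VF n M) p) v = α fun i => c.projF (v i) := rfl

/-- `γ` is a morphism of Lie algebroids onto `TF`: it carries `⟦X, Y⟧` to `[γX, γY]`, and the anchor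
upstairs is `γ` itself. -/
theorem pullbackEquiv_foliatedD (p : ℕ) (α : Form n M F.sections p) :
    (c.pullbackEquiv (p + 1) (F.foliatedD p α) : Form n M (VF n M) (p + 1)) =
      c.d01 p (c.pullbackEquiv p α : Form n M (VF n M) p) := by
  have hb : ∀ X Y, F.algebroid.bracket (c.projF X) (c.projF Y) =
      c.projF (c.algebroid.bracket X Y) := fun X Y => Subtype.ext (c.proj_bracket X Y).symm
  ext v : 1
  rw [← differential_eq_d01, pullbackEquiv_apply, LieAlgebroid.differential_apply,
    LieAlgebroid.differential_apply]
  cases p with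
  | zero =>
    rw [koszulFun, koszulFun, pullbackEquiv_apply,
      Subsingleton.elim (fun i => c.projF ((![] : Fin 0 → VF n M) i)) ![]]
    rfl
  | succ p =>
    rw [koszulFun, koszulFun]
    simp only [hb, pullbackEquiv_apply]
    congr 1
    refine Finset.sum_congr rfl fun i _ => Finset.sum_congr rfl fun j hj => ?_
    congr 2
    funext l
    cases l using Fin.cases <;> rfl

end EhresmannConnection

end FoliatedAlgebroid

end
-- Anchors as bracket morphisms, and the associated operators.
noncomputable section

namespace FoliatedAlgebroid

variable {n : ℕ} {M : Type*} [TopologicalSpace M] [ChartedSpace (EuclideanSpace ℝ (Fin n)) M]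
  [IsManifold (𝓡 n) ∞ M]

/-- Expand the Jacobi identity for `X`, `Y`, `f • Z` by the Leibniz rule: after subtracting `f`
times the identity for `X`, `Y`, `Z`, only this term remains. -/
theorem dirDeriv_lieBr_smul (X Y Z : VF n M) (f : Fun n M) :
    (dirDeriv (lieBr X Y) f - (dirDeriv X (dirDeriv Y f) - dirDeriv Y (dirDeriv X f))) • Z = 0 := by
  have h := lieBr_jacobi X Y (f • Z)
  simp only [lieBr_leibniz, map_add] at h
  rw [lieBr_jacobi X Y Z] at h
  rw [sub_smul, sub_smul]
  simp only [smul_add] at h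
  rw [← sub_eq_zero] at h
  rw [← neg_eq_zero, ← h]
  abel

/-- The Lie bracket of vector fields is the commutator of derivations. This follows from the
Jacobi identity and the Leibniz rule, except at points where all vector fields vanish, and there
both sides are `0`. -/
theorem dirDeriv_lieBr (X Y : VF n M) (f : Fun n M) :
    dirDeriv (lieBr X Y) f = dirDeriv X (dirDeriv Y f) - dirDeriv Y (dirDeriv X f) := by
  rw [← sub_eq_zero]
  ext x
  by_contra hx
  have hZ : ∀ Z : VF n M, Z x = 0 := fun Z => by
    have h := congrArg (fun W : VF n M => W x) (dirDeriv_lieBr_smul X Y Z f)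
    exact (smul_eq_zero.1 h).resolve_left hx
  apply hx
  have h0 : ∀ (Z : VF n M) (g : Fun n M), dirDeriv Z g x = 0 := fun Z g => by
    rw [dirDeriv_apply, hZ Z]
    exact map_zero _
  change dirDeriv (lieBr X Y) f x - (dirDeriv X (dirDeriv Y f) x - dirDeriv Y (dirDeriv X f) x) = 0
  rw [h0, h0, h0, sub_zero, sub_zero]

section

variable {L : Type*} [AddCommGroup L] [Module (Fun n M) L] [Module ℝ L]
  [IsScalarTower ℝ (Fun n M) L] (𝓐 : LieAlgebroid n M L)

theorem LieAlgebroid.isAssociatedOperator_differential :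
    𝓐.IsAssociatedOperator 𝓐.differential where
  on_functions f X := rfl
  on_one_forms α X Y := by
    rw [LieAlgebroid.differential_apply]
    have h := koszulFun_cons (dirDeriv ∘ₗ 𝓐.anchor) 𝓐.bracket α X ![Y]
    have hu : Function.update ![Y] 0 (𝓐.bracket X Y) = ![𝓐.bracket X Y] := by
      funext l
      fin_cases l
      rfl
    refine h.trans ?_
    rw [Fin.sum_univ_one]
    change _ - α (Function.update ![Y] 0 (𝓐.bracket X Y)) - dirDeriv (𝓐.anchor Y) (α ![X]) = _
    rw [hu, sub_right_comm]
    rfl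
  derivation p r α β := koszul_wedgeN (dirDeriv ∘ₗ 𝓐.anchor) 𝓐.bracket 𝓐.bracket_self
    𝓐.leibniz rfl (by omega) rfl α β

/-- Compatibility of the anchor with brackets is not a field of `LieAlgebroid`, so it enters as a
hypothesis. With `dirDeriv_lieBr` it gives the commutator rule on functions. -/
theorem LieAlgebroid.differential_differential
    (h : ∀ X Y, 𝓐.anchor (𝓐.bracket X Y) = lieBr (𝓐.anchor X) (𝓐.anchor Y)) (p : ℕ)
    (θ : Form n M L p) : 𝓐.differential (p + 1) (𝓐.differential p θ) = 0 :=
  koszul_koszul _ _ _ _ 𝓐.jacobi (fun X Y f => by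
    simp only [LinearMap.comp_apply, h, dirDeriv_lieBr]) θ

end

theorem EhresmannConnection.bracket_of_mem_sections {F : RegularFoliation n M}
    (c : EhresmannConnection F) {X Y : VF n M} (hX : X ∈ F.sections) (hY : Y ∈ F.sections) :
    c.algebroid.bracket X Y = lieBr X Y := c.bracket_of_mem_true_true hX hY

end FoliatedAlgebroid

end

theorem mainTheorem10 {n : ℕ} {M : Type*} [TopologicalSpace M] [T2Space M]
    [SecondCountableTopology M] [ChartedSpace (EuclideanSpace ℝ (Fin n)) M]
    [IsManifold (𝓡 n) ∞ M] (F : RegularFoliation n M) (c : EhresmannConnection F) :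
    -- the Koszul differentials of the three Lie algebroids `(TM, Id, [·, ·])`,
    -- `(TM, γ, [·, ·]_γ + T_γ)`, `(TF, j, [·, ·]_F)` are the associated operators
    (tangentAlgebroid n M).IsAssociatedOperator (extD n M) ∧
    c.algebroid.IsAssociatedOperator c.algebroid.differential ∧
    F.algebroid.IsAssociatedOperator F.foliatedD ∧
    -- the last two of them are cohomology operators
    (∀ (p : ℕ) (θ : Form n M (VF n M) p),
      c.algebroid.differential (p + 1) (c.algebroid.differential p θ) = 0) ∧
    (∀ (p : ℕ) (α : Form n M F.sections p), F.foliatedD (p + 1) (F.foliatedD p α) = 0) ∧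
    -- `d_{1,0}`, `d_{0,1}`, `d_{2,-1}` are the components of `d`
    (∀ p : ℕ, extD n M p = c.d10 p + c.d2m1 p + c.d01 p) ∧
    (∀ (p : ℕ) (a b : ℤ) (θ : Form n M (VF n M) p), c.IsOfType a b θ →
      c.IsOfType (a + 1) b (c.d10 p θ) ∧ c.IsOfType a (b + 1) (c.d01 p θ) ∧
        c.IsOfType (a + 2) (b - 1) (c.d2m1 p θ)) ∧
    -- `D = d_{0,1}`
    (∀ p : ℕ, c.algebroid.differential p = c.d01 p) ∧
    -- the restriction to `TF` of the Lie algebroid on `TM` is the Lie algebroid of the foliation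
    (∃ hF : ∀ X ∈ F.sections, ∀ Y ∈ F.sections, c.algebroid.bracket X Y ∈ F.sections,
      c.algebroid.restrict F.sections hF = F.algebroid) ∧
    -- `d_{0,1}` restricts to `Γ(ΛH⁰)`, and the resulting complex is isomorphic to the foliated one
    (∀ p : ℕ, ∀ θ ∈ c.annForms p, c.d01 p θ ∈ c.annForms (p + 1)) ∧
    ∃ h : ∀ p : ℕ, Form n M F.sections p ≃ₗ[Fun n M] c.annForms p,
      (∀ (p : ℕ) (α : Form n M F.sections p) (v : Fin p → VF n M),
        (h p α : Form n M (VF n M) p) v = α fun i => c.projF (v i)) ∧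
      ∀ (p : ℕ) (α : Form n M F.sections p),
        (h (p + 1) (F.foliatedD p α) : Form n M (VF n M) (p + 1)) =
          c.d01 p (h p α : Form n M (VF n M) p) := by
  have hF : ∀ X ∈ F.sections, ∀ Y ∈ F.sections, c.algebroid.bracket X Y ∈ F.sections :=
    fun X hX Y hY => by
      rw [c.bracket_of_mem_sections hX hY]
      exact F.lieBr_mem hX hY
  refine ⟨LieAlgebroid.isAssociatedOperator_differential _,
    LieAlgebroid.isAssociatedOperator_differential _,
    LieAlgebroid.isAssociatedOperator_differential _,
    c.algebroid.differential_differential c.proj_bracket,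
    F.algebroid.differential_differential fun _ _ => rfl, c.extD_eq_add,
    fun p a b θ h => ⟨?_, ?_, ?_⟩, c.differential_eq_d01, ⟨hF, ?_⟩,
    fun p θ h => c.d01_mem_annForms h, c.pullbackEquiv, c.pullbackEquiv_apply,
    c.pullbackEquiv_foliatedD⟩
  · convert c.isOfType_dComponent h 0 using 1 <;> ring
  · convert c.isOfType_dComponent h 1 using 1
    ring
  · convert c.isOfType_dComponent h (-1) using 1
    · ring
    · rw [sub_eq_add_neg]
  -- Two algebroids agree once anchors and brackets do: `γ` is the identity on `Γ(TF)`, and `⟦·, ·⟧`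
  -- is the Lie bracket there.
  · ext X : 2
    · exact c.proj_of_mem X.2
    · ext Y : 1
      exact Subtype.ext (c.bracket_of_mem_sections X.2 Y.2)
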